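/- **Setting.** Let $V^L=(\mathbb C^2)^{\otimes L}$ with its standard scalar product and orthonormal basis $|s_1\cdots s_L\rangle$, $s_j\in\{\uparrow,\downarrow\}$, let $\sigma^a_j$ ($a=x,y,z$) be the Pauli matrices acting on the $j$-th factor, with $\sigma^a_{L+1}=\sigma^a_1$, and for real $\zeta$ let $$H_{\rm XYZ}=-\frac12\sum_{j=1}^L\Big((1+\zeta)\,\sigma^x_j\sigma^x_{j+1}+(1-\zeta)\,\sigma^y_j\sigma^y_{j+1}+\tfrac12(\zeta^2-1)\,\sigma^z_j\sigma^z_{j+1}\Big).$$ Let $\mathcal S|s_1\cdots s_{L-1}s_L\rangle=|s_Ls_1\cdots s_{L-1}\rangle$, and let $W^L\subset V^L$ be the eigenspace of $\mathcal S$ for the eigenvalue $(-1)^{L+1}$ (the alternate-cyclic states). Let $\mathfrak q:\mathbb C^2\to\mathbb C^2\otimes\mathbb C^2$ be given by $\mathfrak q|{\uparrow}\rangle=0$, $\mathfrak q|{\downarrow}\rangle=|{\uparrow\uparrow}\rangle-\zeta|{\downarrow\downarrow}\rangle$, let $\mathfrak q_j:V^L\to V^{L+1}$ ($1\le j\le L$)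 be $\mathfrak q$ acting on the $j$-th factor, and let $\mathfrak q_0=\mathcal S\mathfrak q_L$. The supercharge $\mathfrak Q:V^L\to V^{L+1}$ ($L\ge 1$) is $\sqrt{L/(L+1)}\sum_{j=0}^L(-1)^j\mathfrak q_j$ on $W^L$ and zero on every other eigenspace of $\mathcal S$; $\mathfrak Q^\dagger$ is its adjoint, and $H=\mathfrak Q\mathfrak Q^\dagger+\mathfrak Q^\dagger\mathfrak Q$. An alternate-cyclic zero-energy state is a non-zero $\Psi\in W^L$ with $H\Psi=0$. On $V^{2n+1}$ put $$\Phi_n(\zeta)=\sum_{s:\ d(s)\ \mathrm{odd}}\zeta^{(d(s)-1)/2}\,|s\rangle,\qquad \bar\Phi_n(\zeta)=\sum_{s:\ d(s)\ \mathrm{even}}\zeta^{d(s)/2}\,|s\rangle,$$ where $d(s)$ is the number of spins down in $s=(s_1,\dots,s_{2n+1})$. Denote by $\Psi_n$ (respectively $\bar\Psi_n$) an alternate-cyclic zero-energy state in $V^{2n+1}$ of the form $\lambda_n\Phi_n(\zeta)+\mathfrak Q\alpha_n$ (respectively $\bar\lambda_n\bar\Phi_n(\zeta)+\mathfrak Q\bar\alpha_n$)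 with $\lambda_n,\bar\lambda_n\in\mathbb C$ and $\alpha_n,\bar\alpha_n\in W^{2n}$. **Theorem.** Let $L=2n+1$ with $n\ge1$, and let $\zeta\neq0$ be real. The lowest eigenvalue of $H_{\rm XYZ}$ on the full space $V^{2n+1}$ is $E_0=-(2n+1)(3+\zeta^2)/4$. States $\Psi_n$ and $\bar\Psi_n$ as above exist, and any such $\Psi_n$ and $\bar\Psi_n$ span the whole eigenspace of $H_{\rm XYZ}$ on $V^{2n+1}$ for the eigenvalue $E_0$ (the space of ground states). -/

import Mathlib

noncomputable section

namespace XYZChain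

/-- The Hilbert space `(ℂ²)^{⊗ L}` of a chain of `L` spins `1/2`, in coordinates with respect to the
canonical orthonormal basis `|s₁ ⋯ s_L⟩`. The value `0 : Fin 2` stands for spin up, `1` for spin
down; sites are numbered from `0`. -/
abbrev Chain (L : ℕ) : Type := EuclideanSpace ℂ (Fin L → Fin 2)

/-- The basis state `|s₁ ⋯ s_L⟩`. -/
def ket {L : ℕ} (s : Fin L → Fin 2) : Chain L := EuclideanSpace.single s 1

def pauliX : Matrix (Fin 2) (Fin 2) ℂ := !![0, 1; 1, 0]

def pauliY : Matrix (Fin 2) (Fin 2) ℂ := !![0, -Complex.I; Complex.I, 0]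

def pauliZ : Matrix (Fin 2) (Fin 2) ℂ := !![1, 0; 0, -1]

/-- The operator `1 ⊗ ⋯ ⊗ 1 ⊗ A ⊗ 1 ⊗ ⋯ ⊗ 1` with the matrix `A` acting on the factor `j`. -/
def siteOp {L : ℕ} (A : Matrix (Fin 2) (Fin 2) ℂ) (j : Fin L) : Chain L →ₗ[ℂ] Chain L where
  toFun ψ := WithLp.toLp 2 fun s => ∑ t : Fin 2, A (s j) t * ψ (Function.update s j t)
  map_add' ψ φ := by
    ext s
    simp [mul_add]
    ring
  map_smul' c ψ := by
    ext s
    simp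
    ring

/-- The XYZ Hamiltonian with periodic boundary conditions,
`-(1/2) ∑_j (J_x σ^x_j σ^x_{j+1} + J_y σ^y_j σ^y_{j+1} + J_z σ^z_j σ^z_{j+1})`.
The permutation `finRotate L` is the cyclic successor `j ↦ j + 1` on the sites. -/
def xyzHamiltonian (L : ℕ) (Jx Jy Jz : ℝ) : Chain L →ₗ[ℂ] Chain L :=
  (-(1 / 2) : ℂ) • ∑ j : Fin L,
    ((Jx : ℂ) • (siteOp pauliX j ∘ₗ siteOp pauliX (finRotate L j)) +
     (Jy : ℂ) • (siteOp pauliY j ∘ₗ siteOp pauliY (finRotate L j)) +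
     (Jz : ℂ) • (siteOp pauliZ j ∘ₗ siteOp pauliZ (finRotate L j)))

/-- The XYZ Hamiltonian with the anisotropy parameters
`J_x = 1 + ζ`, `J_y = 1 - ζ`, `J_z = (ζ² - 1) / 2`. -/
def susyXYZ (L : ℕ) (ζ : ℝ) : Chain L →ₗ[ℂ] Chain L :=
  xyzHamiltonian L (1 + ζ) (1 - ζ) ((ζ ^ 2 - 1) / 2)

/-- The translation operator `S |s₁ ⋯ s_{L-1} s_L⟩ = |s_L s₁ ⋯ s_{L-1}⟩`
(see `translation_ket` below). -/
def translation (L : ℕ) : Chain L →ₗ[ℂ] Chain L where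
  toFun ψ := WithLp.toLp 2 fun s => ψ fun k => s (finRotate L k)
  map_add' ψ φ := by
    ext s
    simp
  map_smul' c ψ := by
    ext s
    simp

theorem translation_ket {L : ℕ} (s : Fin L → Fin 2) :
    translation L (ket s) = ket fun k => s ((finRotate L).symm k) := by
  ext t
  have h : (fun k => t (finRotate L k)) = s ↔ t = fun k => s ((finRotate L).symm k) := by
    constructor
    · rintro rfl
      funext k
      simp only [Equiv.apply_symm_apply]
    · rintro rfl
      funext k
      simp only [Equiv.symm_apply_apply]
  simp only [translation, ket, LinearMap.coe_mk, AddHom.coe_mk, PiLp.single_apply, h]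

/-- The space `W^L` of alternate-cyclic states. -/
def altCyclic (L : ℕ) : Submodule ℂ (Chain L) :=
  Module.End.eigenspace (translation L) ((-1) ^ (L + 1))

/-- The matrix element `⟨a b| q |t⟩` of the local supercharge
`q |↑⟩ = 0`, `q |↓⟩ = |↑↑⟩ - ζ |↓↓⟩`. -/
def localCoeff (ζ : ℝ) (a b t : Fin 2) : ℂ :=
  if t = 0 then 0
  else if a = 0 ∧ b = 0 then 1
  else if a = 1 ∧ b = 1 then -(ζ : ℂ)
  else 0

/-- The local supercharge `1 ⊗ ⋯ ⊗ 1 ⊗ q ⊗ 1 ⊗ ⋯ ⊗ 1` with `q` acting on the factor `j`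
(counted from `0`). It replaces the spin at site `j` by two spins at the sites `j` and `j + 1`. -/
def localCharge (ζ : ℝ) {L : ℕ} (j : Fin L) : Chain L →ₗ[ℂ] Chain (L + 1) where
  toFun ψ := WithLp.toLp 2 fun s => ∑ t : Fin 2,
    localCoeff ζ (s j.castSucc) (s j.succ) t * ψ (Function.update (j.succ.removeNth s) j t)
  map_add' ψ φ := by
    ext s
    simp [mul_add]
    ring
  map_smul' c ψ := by
    ext s
    simp
    ring

/-- The boundary local supercharge: the translation operator composed with the local supercharge
on the last site (for `L ≥ 1`). -/
def boundaryCharge (ζ : ℝ) (L : ℕ) : Chain L →ₗ[ℂ] Chain (L + 1) :=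
  if h : 0 < L then
    translation (L + 1) ∘ₗ localCharge ζ (⟨L - 1, Nat.sub_one_lt_of_lt h⟩ : Fin L)
  else 0

/-- The supercharge. It is `√(L / (L + 1)) ∑_{j = 0}^{L} (-1)^j q_j` on the alternate-cyclic states,
where `q_0` is the boundary local supercharge and `q_j`, `1 ≤ j ≤ L`, acts on the `j`-th site, and
zero on every other eigenspace of the (unitary) translation operator, that is, on the orthogonal
complement of the alternate-cyclic states. -/
def supercharge (ζ : ℝ) (L : ℕ) : Chain L →ₗ[ℂ] Chain (L + 1) :=
  (((Real.sqrt ((L : ℝ) / ((L : ℝ) + 1)) : ℝ) : ℂ) •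
    (boundaryCharge ζ L + ∑ j : Fin L, ((-1 : ℂ) ^ ((j : ℕ) + 1)) • localCharge ζ j)) ∘ₗ
  ((altCyclic L).starProjection : Chain L →ₗ[ℂ] Chain L)

/-- The supersymmetric Hamiltonian `H = Q Q† + Q† Q` on the chain with `L + 1` sites. -/
def susyHamiltonian (ζ : ℝ) (L : ℕ) : Chain (L + 1) →ₗ[ℂ] Chain (L + 1) :=
  supercharge ζ L ∘ₗ LinearMap.adjoint (supercharge ζ L) +
    LinearMap.adjoint (supercharge ζ (L + 1)) ∘ₗ supercharge ζ (L + 1)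

/-- Alternate-cyclic zero-energy states of `H` on the chain with `L + 1` sites. -/
def IsAltCyclicZeroEnergy (ζ : ℝ) (L : ℕ) (Ψ : Chain (L + 1)) : Prop :=
  Ψ ≠ 0 ∧ Ψ ∈ altCyclic (L + 1) ∧ susyHamiltonian ζ L Ψ = 0

/-- The spin-parity operator `P = (-1)^L σ^z_1 ⋯ σ^z_L`, which is diagonal. -/
def spinParity (L : ℕ) : Chain L →ₗ[ℂ] Chain L where
  toFun ψ := WithLp.toLp 2 fun s => (-1) ^ L * (∏ j, pauliZ (s j) (s j)) * ψ s
  map_add' ψ φ := by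
    ext s
    simp [mul_add]
  map_smul' c ψ := by
    ext s
    simp
    ring

/-- The state `(1/2) (1 + P) ∑_s |s⟩` on `2 n + 1` sites. -/
def phiOne (n : ℕ) : Chain (2 * n + 1) :=
  (1 / 2 : ℂ) • ((∑ s : Fin (2 * n + 1) → Fin 2, ket s) +
    spinParity (2 * n + 1) (∑ s : Fin (2 * n + 1) → Fin 2, ket s))

/-- The state `(1/2) (1 - P) ∑_s |s⟩` on `2 n + 1` sites. -/
def phiBarOne (n : ℕ) : Chain (2 * n + 1) :=
  (1 / 2 : ℂ) • ((∑ s : Fin (2 * n + 1) → Fin 2, ket s) -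
    spinParity (2 * n + 1) (∑ s : Fin (2 * n + 1) → Fin 2, ket s))

/-- The number of spins down. -/
def numDown {L : ℕ} (s : Fin L → Fin 2) : ℕ := (Finset.univ.filter fun j => s j = 1).card

/-- The state `Φ_n(ζ)`, a polynomial in `ζ`, for every real `ζ`. For `ζ > 0` it is
`ζ^{-(n+1)} M(ζ^{1/2}) Φ_n` (see `phi_eq` below). -/
def phi (n : ℕ) (ζ : ℝ) : Chain (2 * n + 1) :=
  WithLp.toLp 2 fun s => (ζ : ℂ) ^ (numDown s / 2) * phiOne n s

/-- The state `Φ̄_n(ζ)`, a polynomial in `ζ`, for every real `ζ`. For `ζ > 0` it is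
`ζ^{-(n+1/2)} M(ζ^{1/2}) Φ̄_n` (see `phiBar_eq` below). -/
def phiBar (n : ℕ) (ζ : ℝ) : Chain (2 * n + 1) :=
  WithLp.toLp 2 fun s => (ζ : ℂ) ^ (numDown s / 2) * phiBarOne n s

/-- The operator `M(x) = m(x) ⊗ ⋯ ⊗ m(x)`, where `m(x) |↑⟩ = x |↑⟩` and `m(x) |↓⟩ = x² |↓⟩`. -/
def scaling (L : ℕ) (x : ℝ) : Chain L →ₗ[ℂ] Chain L where
  toFun ψ := WithLp.toLp 2 fun s => (∏ j, if s j = 0 then (x : ℂ) else (x : ℂ) ^ 2) * ψ s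
  map_add' ψ φ := by
    ext s
    simp [mul_add]
  map_smul' c ψ := by
    ext s
    simp
    ring

theorem sum_ket_apply {L : ℕ} (s : Fin L → Fin 2) :
    (∑ t : Fin L → Fin 2, ket t : Chain L) s = 1 := by
  simp [ket]

theorem prod_pauliZ {L : ℕ} (s : Fin L → Fin 2) :
    ∏ j, pauliZ (s j) (s j) = (-1) ^ numDown s := by
  have h : ∀ t : Fin 2, pauliZ t t = if t = 1 then (-1 : ℂ) else 1 := by
    intro t
    fin_cases t <;> simp [pauliZ]
  simp only [h, Finset.prod_ite, Finset.prod_const, one_pow, mul_one, numDown]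

theorem phiOne_apply (n : ℕ) (s : Fin (2 * n + 1) → Fin 2) :
    phiOne n s = if Odd (numDown s) then 1 else 0 := by
  have h1 := sum_ket_apply s
  have h2 : (-1 : ℂ) ^ (2 * n + 1) = -1 := by simp [pow_succ, pow_mul]
  simp only [phiOne, spinParity, LinearMap.coe_mk, AddHom.coe_mk, PiLp.smul_apply, PiLp.add_apply,
    h1, h2, prod_pauliZ, smul_eq_mul]
  rcases Nat.even_or_odd (numDown s) with h | h
  · rw [if_neg (Nat.not_odd_iff_even.mpr h), h.neg_one_pow]
    norm_num
  · rw [if_pos h, h.neg_one_pow]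
    norm_num

theorem phiBarOne_apply (n : ℕ) (s : Fin (2 * n + 1) → Fin 2) :
    phiBarOne n s = if Even (numDown s) then 1 else 0 := by
  have h1 := sum_ket_apply s
  have h2 : (-1 : ℂ) ^ (2 * n + 1) = -1 := by simp [pow_succ, pow_mul]
  simp only [phiBarOne, spinParity, LinearMap.coe_mk, AddHom.coe_mk, PiLp.smul_apply,
    PiLp.sub_apply, h1, h2, prod_pauliZ, smul_eq_mul]
  rcases Nat.even_or_odd (numDown s) with h | h
  · rw [if_pos h, h.neg_one_pow]
    norm_num
  · rw [if_neg (Nat.not_even_iff_odd.mpr h), h.neg_one_pow]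
    norm_num

theorem scaling_apply {L : ℕ} (x : ℝ) (ψ : Chain L) (s : Fin L → Fin 2) :
    scaling L x ψ s = (x : ℂ) ^ (L + numDown s) * ψ s := by
  have h : ∀ j, (if s j = 0 then (x : ℂ) else (x : ℂ) ^ 2) =
      (x : ℂ) * if s j = 1 then (x : ℂ) else 1 := by
    intro j
    generalize s j = t
    fin_cases t <;> simp [pow_two]
  simp only [scaling, LinearMap.coe_mk, AddHom.coe_mk]
  rw [Finset.prod_congr rfl fun j _ => h j, Finset.prod_mul_distrib]
  simp only [Finset.prod_ite, Finset.prod_const, one_pow, mul_one, numDown, pow_add,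
    Finset.card_univ, Fintype.card_fin]

theorem phi_eq (n : ℕ) (ζ : ℝ) (hζ : 0 < ζ) :
    phi n ζ = ((ζ : ℂ) ^ (n + 1))⁻¹ • scaling (2 * n + 1) (Real.sqrt ζ) (phiOne n) := by
  ext s
  have hz : (ζ : ℂ) ≠ 0 := by exact_mod_cast hζ.ne'
  have hsq : ((Real.sqrt ζ : ℝ) : ℂ) ^ 2 = (ζ : ℂ) := by
    exact_mod_cast Real.sq_sqrt hζ.le
  simp only [PiLp.smul_apply, scaling_apply, phi, phiOne_apply, smul_eq_mul]
  split_ifs with h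
  · obtain ⟨k, hk⟩ := h
    have h3 : 2 * n + 1 + numDown s = 2 * (n + 1 + k) := by omega
    have h4 : numDown s / 2 = k := by omega
    rw [h3, h4, pow_mul, hsq]
    field_simp
    ring
  · simp

theorem phiBar_eq (n : ℕ) (ζ : ℝ) (hζ : 0 < ζ) :
    phiBar n ζ = ((ζ ^ (-((n : ℝ) + 1 / 2)) : ℝ) : ℂ) •
      scaling (2 * n + 1) (Real.sqrt ζ) (phiBarOne n) := by
  ext s
  have hs : Real.sqrt ζ ≠ 0 := (Real.sqrt_pos.mpr hζ).ne'
  have hsq : Real.sqrt ζ ^ 2 = ζ := Real.sq_sqrt hζ.le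
  have hr : ζ ^ (-((n : ℝ) + 1 / 2)) = (Real.sqrt ζ ^ (2 * n + 1))⁻¹ := by
    rw [Real.rpow_neg hζ.le, Real.rpow_add hζ, ← Real.sqrt_eq_rpow, Real.rpow_natCast, pow_succ,
      pow_mul, hsq]
  simp only [PiLp.smul_apply, scaling_apply, phiBar, phiBarOne_apply, smul_eq_mul]
  split_ifs with h
  · obtain ⟨k, hk⟩ := h
    have h4 : numDown s / 2 = k := by omega
    have h5 : numDown s = 2 * k := by omega
    have hsc : ((Real.sqrt ζ : ℝ) : ℂ) ≠ 0 := by exact_mod_cast hs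
    have hsqc : ((Real.sqrt ζ : ℝ) : ℂ) ^ 2 = (ζ : ℂ) := by exact_mod_cast hsq
    rw [h4, h5, hr, pow_add ((Real.sqrt ζ : ℝ) : ℂ) (2 * n + 1) (2 * k), pow_mul _ 2 k, hsqc]
    push_cast
    field_simp
  · simp

/-- `Ψ` is a state `Ψ_n` (determined up to a non-zero factor): an alternate-cyclic zero-energy state
on `2 n + 1` sites of the form `c Φ_n(ζ) + Q α` with `α` alternate-cyclic on `2 n` sites. -/
def IsPsi (n : ℕ) (ζ : ℝ) (Ψ : Chain (2 * n + 1)) : Prop :=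
  IsAltCyclicZeroEnergy ζ (2 * n) Ψ ∧
    ∃ c : ℂ, ∃ α ∈ altCyclic (2 * n), Ψ = c • phi n ζ + supercharge ζ (2 * n) α

/-- `Ψ` is a state `Ψ̄_n` (determined up to a non-zero factor): an alternate-cyclic zero-energy state
on `2 n + 1` sites of the form `c Φ̄_n(ζ) + Q α` with `α` alternate-cyclic on `2 n` sites. -/
def IsPsiBar (n : ℕ) (ζ : ℝ) (Ψ : Chain (2 * n + 1)) : Prop :=
  IsAltCyclicZeroEnergy ζ (2 * n) Ψ ∧
    ∃ c : ℂ, ∃ α ∈ altCyclic (2 * n), Ψ = c • phiBar n ζ + supercharge ζ (2 * n) α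

/-- `E` is the ground-state energy of the (Hermitian) operator `T`: its lowest eigenvalue.
The ground states are then the eigenvectors of `T` for the eigenvalue `E`. -/
def IsGroundEnergy {L : ℕ} (T : Chain L →ₗ[ℂ] Chain L) (E : ℝ) : Prop :=
  IsLeast {x : ℝ | Module.End.HasEigenvalue T (x : ℂ)} E

end XYZChain

end

noncomputable section

namespace XYZChain

open ComplexConjugate

/-! Write K for the XYZ Hamiltonian minus the claimed energy (`shiftedXYZ`). The claim becomes: K is
non-negative, and its kernel is spanned by the two zero-energy states.

On alternate-cyclic states of odd length, ⟨ψ, Kψ⟩ = ‖Qψ‖² + ‖Q†ψ‖²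
(`inner_shiftedXYZ_eq_supercharge`). Both Q and Q† are signed sums of translates of one local
operator. When the norms are expanded, contributions of far-apart sites cancel between the two
terms, and the remainder is a sum over bonds. Thus K is non-negative in this sector and annihilates
the zero-energy states.

A Perron–Frobenius argument removes the restriction to the sector. The diagonal sign change
`gaugeSign` makes all off-diagonal matrix elements of K non-positive, so replacing the coordinates
of a vector by their gauged moduli does not raise its energy. Starting from a minimizer, this yields
another minimizer whose translates overlap non-negatively; their sum is a non-zero lowest
eigenvector in the sector, where K is non-negative (`re_inner_shiftedXYZ_nonneg`). For ζ ≠ 0, a zero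
coordinate of a kernel vector forces zeros at all configurations reached by reversing two
neighbouring spins. These moves preserve only the parity of the number of spins down, so two
coordinates determine a kernel vector and the kernel has dimension at most 2
(`finrank_ker_shiftedXYZ_le`).

Two independent elements come from Hodge theory. The states Φ and Φ̄ are annihilated by Q, and Q² =
0 (`supercharge_supercharge`); subtracting from each its projection onto the range of Q gives a
vector killed by both Q and Q†. Explicit dual vectors orthogonal to the range of Q pair
non-trivially with Φ and Φ̄ in matching parity, which gives non-vanishing and independence. -/

/-! ### Words as coordinates: concatenation and rotation of lists replace index arithmetic on sites
-/

/-- The sum of `f` over all words of length `m`. -/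
def wordSum : ℕ → (List (Fin 2) → ℂ) → ℂ
  | 0, f => f []
  | m + 1, f => ∑ a : Fin 2, wordSum m fun l => f (a :: l)

theorem sum_ofFn (L : ℕ) (f : List (Fin 2) → ℂ) :
    ∑ s : Fin L → Fin 2, f (List.ofFn s) = wordSum L f := by
  induction L generalizing f with
  | zero => simp [wordSum]
  | succ m ih =>
    rw [← (Fin.consEquiv fun _ => Fin 2).sum_comp, Fintype.sum_prod_type]
    simp only [wordSum, ← ih]
    refine Finset.sum_congr rfl fun a _ => Finset.sum_congr rfl fun s _ => ?_
    simp [Fin.consEquiv, List.ofFn_succ]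

theorem wordSum_congr {L : ℕ} {f g : List (Fin 2) → ℂ} (h : ∀ l, l.length = L → f l = g l) :
    wordSum L f = wordSum L g := by
  induction L generalizing f g with
  | zero => exact h _ rfl
  | succ m ih =>
    exact Finset.sum_congr rfl fun a _ => ih fun l hl => h _ (by simp [hl])

theorem wordSum_add (m k : ℕ) (f : List (Fin 2) → ℂ) :
    wordSum (m + k) f = wordSum m fun X => wordSum k fun Y => f (X ++ Y) := by
  induction m generalizing f with
  | zero => simp [wordSum]
  | succ m ih =>
    rw [Nat.add_right_comm]
    simp [wordSum, ih]

theorem wordSum_sum {ι : Type*} (t : Finset ι) (m : ℕ) (f : ι → List (Fin 2) → ℂ) :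
    wordSum m (fun l => ∑ i ∈ t, f i l) = ∑ i ∈ t, wordSum m (f i) := by
  simp only [← sum_ofFn]
  exact Finset.sum_comm

theorem wordSum_plus (m : ℕ) (f g : List (Fin 2) → ℂ) :
    wordSum m (fun l => f l + g l) = wordSum m f + wordSum m g := by
  simp only [← sum_ofFn, Finset.sum_add_distrib]

theorem wordSum_sub (m : ℕ) (f g : List (Fin 2) → ℂ) :
    wordSum m (fun l => f l - g l) = wordSum m f - wordSum m g := by
  simp only [← sum_ofFn, Finset.sum_sub_distrib]

theorem wordSum_mul (m : ℕ) (c : ℂ) (f : List (Fin 2) → ℂ) :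
    wordSum m (fun l => c * f l) = c * wordSum m f := by
  simp only [← sum_ofFn, Finset.mul_sum]

@[simp] theorem wordSum_zero (m : ℕ) : wordSum m (fun _ => 0) = 0 := by
  simp [← sum_ofFn]

theorem wordSum_succ_last (m : ℕ) (f : List (Fin 2) → ℂ) :
    wordSum (m + 1) f = ∑ a : Fin 2, wordSum m fun X => f (X ++ [a]) := by
  rw [wordSum_add, ← wordSum_sum]
  rfl

theorem wordSum_rotate_one (L : ℕ) (f : List (Fin 2) → ℂ) :
    wordSum L (fun l => f (l.rotate 1)) = wordSum L f := by
  cases L with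
  | zero => rfl
  | succ m =>
    rw [wordSum_succ_last m f]
    simp [wordSum]

/-- The coordinates of a state, indexed by words. -/
def word (L : ℕ) : Chain L →ₗ[ℂ] (List (Fin 2) → ℂ) where
  toFun ψ l := if h : l.length = L then ψ (fun i => l.get (i.cast h.symm)) else 0
  map_add' ψ φ := by
    ext l
    simp only [Pi.add_apply]
    split_ifs <;> simp
  map_smul' c ψ := by
    ext l
    simp only [Pi.smul_apply]
    split_ifs <;> simp

theorem word_apply {L : ℕ} (ψ : Chain L) (l : List (Fin 2)) (h : l.length = L) :
    word L ψ l = ψ (fun i => l.get (i.cast h.symm)) := dif_pos h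

@[simp] theorem word_ofFn {L : ℕ} (ψ : Chain L) (s : Fin L → Fin 2) :
    word L ψ (List.ofFn s) = ψ s := by
  rw [word_apply _ _ (by simp)]
  refine congrArg ψ (funext fun i => ?_)
  simp

theorem word_of_length_ne {L : ℕ} (ψ : Chain L) (l : List (Fin 2)) (h : l.length ≠ L) :
    word L ψ l = 0 := dif_neg h

/-- The state with given coordinates. -/
def ofWord (L : ℕ) (f : List (Fin 2) → ℂ) : Chain L := WithLp.toLp 2 fun s => f (List.ofFn s)

theorem ofFn_get_cast {L : ℕ} (l : List (Fin 2)) (h : l.length = L) :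
    List.ofFn (fun i : Fin L => l.get (i.cast h.symm)) = l := by
  subst h
  exact List.ofFn_get l

theorem word_ofWord {L : ℕ} (f : List (Fin 2) → ℂ) (l : List (Fin 2)) (h : l.length = L) :
    word L (ofWord L f) l = f l := by
  rw [word_apply _ _ h]
  exact congrArg f (ofFn_get_cast l h)

theorem word_ext {L : ℕ} {ψ φ : Chain L}
    (h : ∀ l : List (Fin 2), l.length = L → word L ψ l = word L φ l) : ψ = φ := by
  ext s
  simpa using h (List.ofFn s) (by simp)

theorem inner_eq_wordSum {L : ℕ} (φ ψ : Chain L) :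
    inner ℂ φ ψ = wordSum L fun l => conj (word L φ l) * word L ψ l := by
  rw [← sum_ofFn]
  simp [PiLp.inner_apply, mul_comm]

/-! ### Translation and the projection onto alternate-cyclic states -/

theorem ofFn_comp_finRotate {L : ℕ} (s : Fin L → Fin 2) :
    List.ofFn (fun k => s (finRotate L k)) = (List.ofFn s).rotate 1 := by
  cases L with
  | zero => rfl
  | succ m =>
    refine List.ext_getElem (by simp) fun i h1 h2 => ?_
    simp only [List.getElem_ofFn, List.getElem_rotate, finRotate_apply, List.length_ofFn]
    congr 1
    ext
    simp [Fin.val_add]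

theorem word_translation {L : ℕ} (ψ : Chain L) (l : List (Fin 2)) :
    word L (translation L ψ) l = word L ψ (l.rotate 1) := by
  by_cases h : l.length = L
  · obtain ⟨s, rfl⟩ : ∃ s : Fin L → Fin 2, l = List.ofFn s :=
      ⟨_, (ofFn_get_cast l h).symm⟩
    rw [word_ofFn, ← ofFn_comp_finRotate, word_ofFn]
    rfl
  · rw [word_of_length_ne _ _ h, word_of_length_ne _ _ (by simpa using h)]

theorem word_translation_pow {L : ℕ} (k : ℕ) (ψ : Chain L) (l : List (Fin 2)) :
    word L ((translation L ^ k) ψ) l = word L ψ (l.rotate k) := by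
  induction k generalizing ψ with
  | zero => simp
  | succ k ih =>
    rw [pow_succ, Module.End.mul_apply, ih, word_translation, List.rotate_rotate]

theorem inner_translation {L : ℕ} (φ ψ : Chain L) :
    inner ℂ (translation L φ) (translation L ψ) = inner ℂ φ ψ := by
  simp only [inner_eq_wordSum, word_translation]
  exact wordSum_rotate_one L fun l => conj (word L φ l) * word L ψ l

theorem inner_translation_pow {L : ℕ} (k : ℕ) (φ ψ : Chain L) :
    inner ℂ ((translation L ^ k) φ) ((translation L ^ k) ψ) = inner ℂ φ ψ := by
  induction k with
  | zero => rfl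
  | succ k ih =>
    rw [pow_succ', Module.End.mul_apply, Module.End.mul_apply, inner_translation, ih]

theorem translation_pow_self (L : ℕ) : translation L ^ L = 1 := by
  ext1 ψ
  refine word_ext fun l hl => ?_
  have h : l.rotate L = l := by
    rw [← hl, List.rotate_length]
  rw [word_translation_pow, h]
  rfl

/-- The sign of the alternate-cyclic sector. -/
def altSign (L : ℕ) : ℂ := (-1) ^ (L + 1)

theorem altSign_mul_self (L : ℕ) : altSign L * altSign L = 1 := by
  rw [altSign, ← mul_pow]
  simp

theorem altSign_pow_self (L : ℕ) : altSign L ^ L = 1 := by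
  rw [altSign, ← pow_mul]
  refine Even.neg_one_pow ?_
  rw [mul_comm]
  exact Nat.even_mul_succ_self L

theorem conj_altSign_pow (L k : ℕ) : conj (altSign L ^ k) = altSign L ^ k := by
  simp [altSign]

theorem altSign_of_odd {L : ℕ} (h : Odd L) : altSign L = 1 := h.add_one.neg_one_pow

theorem altSign_of_even {L : ℕ} (h : Even L) : altSign L = -1 := h.add_one.neg_one_pow

theorem mem_altCyclic {L : ℕ} {ψ : Chain L} :
    ψ ∈ altCyclic L ↔ translation L ψ = altSign L • ψ := Module.End.mem_eigenspace_iff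

theorem translation_pow_of_mem {L : ℕ} {ψ : Chain L} (h : ψ ∈ altCyclic L) (k : ℕ) :
    (translation L ^ k) ψ = altSign L ^ k • ψ := by
  induction k with
  | zero => simp
  | succ k ih =>
    rw [pow_succ', Module.End.mul_apply, ih, map_smul, mem_altCyclic.1 h, smul_smul, pow_succ]

theorem word_rotate_of_mem {L : ℕ} {ψ : Chain L} (h : ψ ∈ altCyclic L) (k : ℕ)
    (l : List (Fin 2)) : word L ψ (l.rotate k) = altSign L ^ k * word L ψ l := by
  rw [← word_translation_pow, translation_pow_of_mem h, map_smul]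
  rfl

theorem word_append_comm {L : ℕ} {ψ : Chain L} (h : ψ ∈ altCyclic L) (X Y : List (Fin 2)) :
    word L ψ (Y ++ X) = altSign L ^ X.length * word L ψ (X ++ Y) := by
  rw [← word_rotate_of_mem h, List.rotate_append_length_eq]

/-- The alternating sum over translates; it is `N` times the orthogonal projection onto the
alternate-cyclic states. -/
def altSum (N : ℕ) : Chain N →ₗ[ℂ] Chain N :=
  ∑ k ∈ Finset.range N, altSign N ^ k • translation N ^ k

theorem altSum_apply {N : ℕ} (x : Chain N) :
    altSum N x = ∑ k ∈ Finset.range N, altSign N ^ k • (translation N ^ k) x := by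
  simp [altSum]

theorem altSum_translation {N : ℕ} (x : Chain N) :
    altSum N (translation N x) = altSign N • altSum N x := by
  have h : ∀ k, (translation N ^ k) (translation N x) = (translation N ^ (k + 1)) x := fun k => by
    rw [pow_succ, Module.End.mul_apply]
  have h2 : ∀ k, altSign N ^ k = altSign N * altSign N ^ (k + 1) := fun k => by
    rw [pow_succ', ← mul_assoc, altSign_mul_self, one_mul]
  -- The sum over 0, …, N is split off at either end. Its end terms agree because both the
  -- translation and the sign have N-th power 1.
  have h3 := Finset.sum_range_succ (fun k => altSign N ^ k • (translation N ^ k) x) N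
  rw [Finset.sum_range_succ'] at h3
  simp only [translation_pow_self, altSign_pow_self, pow_zero, add_left_inj] at h3
  rw [altSum_apply, altSum_apply, ← h3, Finset.smul_sum]
  refine Finset.sum_congr rfl fun k _ => ?_
  rw [h, h2 k, smul_smul]

theorem altSum_translation_pow {N : ℕ} (k : ℕ) (x : Chain N) :
    altSum N ((translation N ^ k) x) = altSign N ^ k • altSum N x := by
  induction k with
  | zero => simp
  | succ k ih =>
    rw [pow_succ', Module.End.mul_apply, altSum_translation, ih, smul_smul, pow_succ']

theorem altSum_mem {N : ℕ} (x : Chain N) : altSum N x ∈ altCyclic N := by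
  rw [mem_altCyclic, ← altSum_translation, altSum_apply, altSum_apply, map_sum]
  refine Finset.sum_congr rfl fun k _ => ?_
  rw [map_smul, ← Module.End.mul_apply, ← Module.End.mul_apply, pow_mul_comm']

theorem inner_altSum {N : ℕ} {ψ : Chain N} (h : ψ ∈ altCyclic N) (x : Chain N) :
    inner ℂ ψ (altSum N x) = N * inner ℂ ψ x := by
  have h1 : ∀ k, inner ℂ ψ (altSign N ^ k • (translation N ^ k) x) = inner ℂ ψ x := fun k => by
    rw [← inner_translation_pow k ψ x, translation_pow_of_mem h, inner_smul_left,
      inner_smul_right, conj_altSign_pow]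
  simp [altSum_apply, h1]

theorem starProjection_altCyclic {N : ℕ} (hN : N ≠ 0) (x : Chain N) :
    (altCyclic N).starProjection x = (N : ℂ)⁻¹ • altSum N x := by
  have hN' : (N : ℂ) ≠ 0 := by exact_mod_cast hN
  refine Submodule.eq_starProjection_of_mem_of_inner_eq_zero
    (Submodule.smul_mem _ _ (altSum_mem x)) fun w hw => ?_
  rw [inner_eq_zero_symm, inner_sub_right, inner_smul_right, inner_altSum hw,
    inv_mul_cancel_left₀ hN', sub_self]

theorem inner_altSum_self {N : ℕ} (x : Chain N) :
    inner ℂ (altSum N x) (altSum N x) = N * inner ℂ (altSum N x) x :=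
  inner_altSum (altSum_mem x) x

theorem inner_altSum_left {N : ℕ} {ψ : Chain N} (h : ψ ∈ altCyclic N) (x : Chain N) :
    inner ℂ (altSum N x) ψ = N * inner ℂ x ψ := by
  rw [← inner_conj_symm, inner_altSum h, map_mul, inner_conj_symm, Complex.conj_natCast]

/-! ### The supercharge and its adjoint as symmetrized one-site operators -/

/-- The scalar `localCoeff ζ a b 1`. -/
def pairWeight (ζ : ℝ) (a b : Fin 2) : ℂ := localCoeff ζ a b 1

@[simp] theorem pairWeight_zero_zero (ζ : ℝ) : pairWeight ζ 0 0 = 1 := by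
  simp [pairWeight, localCoeff]

@[simp] theorem pairWeight_one_one (ζ : ℝ) : pairWeight ζ 1 1 = -ζ := by
  simp [pairWeight, localCoeff]

@[simp] theorem pairWeight_zero_one (ζ : ℝ) : pairWeight ζ 0 1 = 0 := by
  simp [pairWeight, localCoeff]

@[simp] theorem pairWeight_one_zero (ζ : ℝ) : pairWeight ζ 1 0 = 0 := by
  simp [pairWeight, localCoeff]

@[simp] theorem conj_pairWeight (ζ : ℝ) (a b : Fin 2) :
    conj (pairWeight ζ a b) = pairWeight ζ a b := by
  fin_cases a <;> fin_cases b <;> simp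

/-- The coordinates of the local supercharge on the first site. -/
def splitWord (ζ : ℝ) (f : List (Fin 2) → ℂ) : List (Fin 2) → ℂ
  | a :: b :: X => pairWeight ζ a b * f (1 :: X)
  | _ => 0

/-- The local supercharge on the first site. -/
def split (ζ : ℝ) {L : ℕ} (ψ : Chain L) : Chain (L + 1) :=
  ofWord (L + 1) (splitWord ζ (word L ψ))

theorem word_split (ζ : ℝ) {L : ℕ} (ψ : Chain L) (a b : Fin 2) (X : List (Fin 2))
    (h : X.length + 1 = L) :
    word (L + 1) (split ζ ψ) (a :: b :: X) = pairWeight ζ a b * word L ψ (1 :: X) := by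
  rw [split, word_ofWord _ _ (by simp; omega)]
  rfl

theorem word_localCharge (ζ : ℝ) {L : ℕ} (j : Fin L) (ψ : Chain L) (a b : Fin 2)
    (X Y : List (Fin 2)) (hX : X.length = j) (h : X.length + Y.length + 1 = L) :
    word (L + 1) (localCharge ζ j ψ) (X ++ a :: b :: Y) =
      pairWeight ζ a b * word L ψ (X ++ 1 :: Y) := by
  have hl : (X ++ a :: b :: Y).length = L + 1 := by simp; omega
  have hl' : (X ++ 1 :: Y).length = L := by simp; omega
  have h0 : localCoeff ζ a b 0 = 0 := by simp [localCoeff]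
  have ha : (X ++ a :: b :: Y).get ((j.castSucc).cast hl.symm) = a := by
    simp [← hX]
  have hb : (X ++ a :: b :: Y).get ((j.succ).cast hl.symm) = b := by
    simp [← hX, List.getElem_append_right]
  have hu : Function.update (j.succ.removeNth
      fun i : Fin (L + 1) => (X ++ a :: b :: Y).get (i.cast hl.symm)) j 1 =
      fun i : Fin L => (X ++ 1 :: Y).get (i.cast hl'.symm) := by
    funext i
    rcases lt_trichotomy i j with hij | rfl | hij
    · have h1 : (i : ℕ) < X.length := by rw [hX]; exact hij
      have h2 : j.succ.succAbove i = i.castSucc :=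
        Fin.succAbove_of_castSucc_lt _ _ (by rw [Fin.lt_def] at hij ⊢; simp; omega)
      rw [Function.update_of_ne hij.ne]
      simp [Fin.removeNth, h2, List.getElem_append_left h1]
    · simp [← hX]
    · have h1 : X.length < (i : ℕ) := by rw [hX]; exact hij
      have h2 : j.succ.succAbove i = i.succ :=
        Fin.succAbove_of_le_castSucc _ _ (by rw [Fin.lt_def] at hij; rw [Fin.le_def]; simp; omega)
      obtain ⟨c, hc⟩ := Nat.exists_eq_add_of_lt h1
      rw [Function.update_of_ne hij.ne']
      have h3 : (i : ℕ) + 1 - X.length = c + 2 := by omega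
      have h4 : (i : ℕ) - X.length = c + 1 := by omega
      simp [Fin.removeNth, h2, List.getElem_append_right, h1.le, h1.le.trans (Nat.le_succ _), h3, h4]
  rw [word_apply _ _ hl, word_apply _ _ hl', ← hu]
  simp only [localCharge, LinearMap.coe_mk, AddHom.coe_mk, Fin.sum_univ_two, ha, hb, h0, zero_mul,
    zero_add, pairWeight]

theorem exists_eq_append_cons_cons {l : List (Fin 2)} {k : ℕ} (h : k + 2 ≤ l.length) :
    ∃ (X : List (Fin 2)) (a b : Fin 2) (Y : List (Fin 2)),
      l = X ++ a :: b :: Y ∧ X.length = k ∧ k + 2 + Y.length = l.length := by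
  refine ⟨l.take k, l[k], l[k + 1], l.drop (k + 2), ?_, by simp; omega, by simp; omega⟩
  rw [← List.drop_eq_getElem_cons, ← List.drop_eq_getElem_cons, List.take_append_drop]

theorem exists_eq_cons_append_singleton {l : List (Fin 2)} (h : 2 ≤ l.length) :
    ∃ (a : Fin 2) (X : List (Fin 2)) (b : Fin 2),
      l = a :: (X ++ [b]) ∧ X.length + 2 = l.length := by
  obtain ⟨a, l', rfl⟩ := List.exists_cons_of_length_pos (by omega : 0 < l.length)
  have h' : l' ≠ [] := by
    rintro rfl
    simp at h
  refine ⟨a, l'.dropLast, l'.getLast h', by rw [List.dropLast_append_getLast], ?_⟩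
  simp at h ⊢
  omega

theorem altSign_succ_pow_mul (L k : ℕ) : altSign (L + 1) ^ k * altSign L ^ k = (-1) ^ k := by
  rw [← mul_pow, altSign, pow_succ, ← altSign, mul_right_comm, altSign_mul_self, one_mul]

theorem altSign_succ_pow (L : ℕ) : altSign (L + 1) ^ L = - altSign L := by
  have h : altSign (L + 1) = - altSign L := by simp [altSign, pow_succ]
  rw [h, neg_pow, altSign_pow_self, mul_one, altSign, pow_succ]
  simp

theorem word_altSum {N : ℕ} (x : Chain N) (l : List (Fin 2)) :
    word N (altSum N x) l = ∑ k ∈ Finset.range N, altSign N ^ k * word N x (l.rotate k) := by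
  rw [altSum_apply, map_sum, Finset.sum_apply]
  refine Finset.sum_congr rfl fun k _ => ?_
  rw [map_smul, Pi.smul_apply, word_translation_pow, smul_eq_mul]

/-- Rotating a word by k brings the pair created at site k to the front, so on alternate-cyclic
states each local supercharge is a translate of `split`. The signs of the sectors of lengths L and L
+ 1 multiply to the alternating sign (-1)^k. The last rotation, k = L, pairs the last letter with
the first and gives the boundary term. -/
theorem sum_localCharge_eq (ζ : ℝ) {L : ℕ} (hL : 0 < L) {φ : Chain L} (h : φ ∈ altCyclic L) :
    (boundaryCharge ζ L + ∑ j : Fin L, ((-1 : ℂ) ^ ((j : ℕ) + 1)) • localCharge ζ j) φ =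
      -altSum (L + 1) (split ζ φ) := by
  refine word_ext fun l hl => ?_
  have hk : ∀ k : Fin L, altSign (L + 1) ^ (k : ℕ) * word (L + 1) (split ζ φ) (l.rotate k) =
      (-1) ^ (k : ℕ) * word (L + 1) (localCharge ζ k φ) l := fun k => by
    obtain ⟨X, a, b, Y, rfl, hX, hY⟩ :=
      exists_eq_append_cons_cons (l := l) (k := k) (by have := k.2; omega)
    rw [word_localCharge ζ k φ a b X Y hX (by omega), ← altSign_succ_pow_mul L, ← hX,
      List.rotate_append_length_eq, List.cons_append, List.cons_append,
      word_split _ _ _ _ _ (by simp; omega), ← List.cons_append, word_append_comm h X (1 :: Y)]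
    ring
  have hb : altSign (L + 1) ^ L * word (L + 1) (split ζ φ) (l.rotate L) =
      - word (L + 1) (boundaryCharge ζ L φ) l := by
    obtain ⟨a, X, b, rfl, hX⟩ := exists_eq_cons_append_singleton (l := l) (by omega)
    have h1 : (a :: (X ++ [b])).rotate L = b :: a :: X := by
      have : L = (a :: X).length := by simp; omega
      rw [this, ← List.cons_append, List.rotate_append_length_eq]
      rfl
    have h2 : (a :: (X ++ [b])).rotate 1 = X ++ b :: a :: [] := by simp
    rw [h1, word_split _ _ _ _ _ (by omega), boundaryCharge, dif_pos hL, LinearMap.comp_apply,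
      word_translation, h2, word_localCharge ζ _ φ b a X [] (by simp; omega) (by simp; omega),
      word_append_comm h [1] X, altSign_succ_pow]
    simp
    ring
  rw [map_neg, Pi.neg_apply, word_altSum, Finset.sum_range_succ, hb, Finset.sum_range]
  simp only [hk]
  rw [LinearMap.add_apply, LinearMap.sum_apply, map_add, map_sum, Pi.add_apply, Finset.sum_apply]
  simp [pow_succ]

theorem supercharge_apply (ζ : ℝ) {L : ℕ} (hL : 0 < L) (φ : Chain L) :
    supercharge ζ L φ = (-(Real.sqrt ((L : ℝ) / ((L : ℝ) + 1)) : ℝ) : ℂ) •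
      altSum (L + 1) (split ζ ((altCyclic L).starProjection φ)) := by
  rw [supercharge, LinearMap.comp_apply, LinearMap.smul_apply]
  erw [sum_localCharge_eq ζ hL (Submodule.starProjection_apply_mem _ φ)]
  simp

theorem supercharge_mem (ζ : ℝ) {L : ℕ} (hL : 0 < L) (φ : Chain L) :
    supercharge ζ L φ ∈ altCyclic (L + 1) := by
  rw [supercharge_apply ζ hL]
  exact Submodule.smul_mem _ _ (altSum_mem _)

theorem starProjection_of_mem {L : ℕ} {φ : Chain L} (h : φ ∈ altCyclic L) :
    (altCyclic L).starProjection φ = φ :=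
  Submodule.starProjection_eq_self_iff.2 h

theorem supercharge_starProjection (ζ : ℝ) {L : ℕ} (φ : Chain L) :
    supercharge ζ L ((altCyclic L).starProjection φ) = supercharge ζ L φ := by
  rw [supercharge, LinearMap.comp_apply, LinearMap.comp_apply]
  congr 1
  exact starProjection_of_mem (Submodule.starProjection_apply_mem _ φ)

theorem inner_supercharge (ζ : ℝ) {L : ℕ} (hL : 0 < L) {ψ : Chain (L + 1)}
    (h : ψ ∈ altCyclic (L + 1)) (φ : Chain L) :
    inner ℂ ψ (supercharge ζ L φ) = (-(Real.sqrt ((L : ℝ) / ((L : ℝ) + 1)) : ℝ) : ℂ) *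
      ((L + 1 : ℂ) * inner ℂ ψ (split ζ ((altCyclic L).starProjection φ))) := by
  rw [supercharge_apply ζ hL, inner_smul_right, inner_altSum h]
  push_cast
  rfl

theorem inner_split (ζ : ℝ) {L : ℕ} (ψ : Chain (L + 2)) (φ : Chain (L + 1)) :
    inner ℂ ψ (split ζ φ) = wordSum L fun X =>
      conj (word _ ψ (0 :: 0 :: X) - ζ * word _ ψ (1 :: 1 :: X)) * word _ φ (1 :: X) := by
  rw [inner_eq_wordSum]
  simp only [wordSum, Fin.sum_univ_two, ← wordSum_plus]
  refine wordSum_congr fun X hX => ?_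
  rw [word_split _ _ _ _ _ (by omega), word_split _ _ _ _ _ (by omega),
    word_split _ _ _ _ _ (by omega), word_split _ _ _ _ _ (by omega)]
  simp
  ring

/-- The coordinates of the image under the adjoint of the local supercharge on the first site. -/
def mergeWord (ζ : ℝ) (f : List (Fin 2) → ℂ) : List (Fin 2) → ℂ
  | [] => 0
  | a :: X => if a = 1 then f (0 :: 0 :: X) - ζ * f (1 :: 1 :: X) else 0

/-- The adjoint of the local supercharge on the first site. -/
def merge (ζ : ℝ) {L : ℕ} (ψ : Chain (L + 1)) : Chain L :=
  ofWord L (mergeWord ζ (word (L + 1) ψ))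

theorem word_merge_zero (ζ : ℝ) {L : ℕ} (ψ : Chain (L + 1)) (X : List (Fin 2))
    (h : X.length + 1 = L) : word L (merge ζ ψ) (0 :: X) = 0 := by
  rw [merge, word_ofWord _ _ (by simp; omega)]
  simp [mergeWord]

theorem word_merge_one (ζ : ℝ) {L : ℕ} (ψ : Chain (L + 1)) (X : List (Fin 2))
    (h : X.length + 1 = L) : word L (merge ζ ψ) (1 :: X) =
      word _ ψ (0 :: 0 :: X) - ζ * word _ ψ (1 :: 1 :: X) := by
  rw [merge, word_ofWord _ _ (by simp; omega)]
  simp [mergeWord]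

theorem inner_merge (ζ : ℝ) {L : ℕ} (ψ : Chain (L + 2)) (φ : Chain (L + 1)) :
    inner ℂ (merge ζ ψ) φ = inner ℂ ψ (split ζ φ) := by
  rw [inner_split, inner_eq_wordSum]
  simp only [wordSum, Fin.sum_univ_two, ← wordSum_plus]
  refine wordSum_congr fun X hX => ?_
  rw [word_merge_zero _ _ _ (by omega), word_merge_one _ _ _ (by omega)]
  simp

theorem inner_altSum_comm {N : ℕ} (hN : N ≠ 0) (x y : Chain N) :
    inner ℂ (altSum N x) y = inner ℂ x (altSum N y) := by
  have hN' : (N : ℂ) ≠ 0 := by exact_mod_cast hN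
  refine mul_left_cancel₀ hN' ?_
  rw [← inner_altSum (altSum_mem x), ← inner_altSum_left (altSum_mem y)]

/-- In the constant, L + 2 comes from pairing an alternate-cyclic vector with `altSum`, and 1 / (L +
1) from the projection contained in the supercharge, which is moved onto `merge ζ ψ`. -/
theorem adjoint_supercharge_of_mem (ζ : ℝ) {L : ℕ} {ψ : Chain (L + 2)}
    (h : ψ ∈ altCyclic (L + 2)) :
    LinearMap.adjoint (supercharge ζ (L + 1)) ψ =
      (-(Real.sqrt (((L + 1 : ℕ) : ℝ) / (((L + 1 : ℕ) : ℝ) + 1)) : ℝ) * ((L + 2 : ℂ) / (L + 1)) : ℂ) •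
        altSum (L + 1) (merge ζ ψ) := by
  refine ext_inner_right ℂ fun φ => ?_
  have hL : (L : ℂ) + 1 ≠ 0 := by exact_mod_cast L.succ_ne_zero
  rw [LinearMap.adjoint_inner_left, inner_supercharge ζ L.succ_pos h, ← inner_merge,
    inner_smul_left, starProjection_altCyclic L.succ_ne_zero, inner_smul_right,
    inner_altSum_comm L.succ_ne_zero]
  simp only [map_mul, map_neg, Complex.conj_ofReal, map_div₀, map_add, Complex.conj_natCast, map_one,
    Complex.conj_ofNat]
  push_cast
  field_simp
  ring

/-! ### The sum of the squared norms of Qψ and Q†ψ as a sum over bonds -/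

theorem sqrt_mul_self_complex (L : ℕ) :
    ((Real.sqrt ((L : ℝ) / ((L : ℝ) + 1)) : ℝ) : ℂ) * (Real.sqrt ((L : ℝ) / ((L : ℝ) + 1)) : ℝ) =
      L / (L + 1) := by
  rw [← Complex.ofReal_mul, Real.mul_self_sqrt (by positivity)]
  push_cast
  rfl

theorem inner_supercharge_self (ζ : ℝ) {L : ℕ} (hL : 0 < L) {ψ : Chain L} (h : ψ ∈ altCyclic L) :
    inner ℂ (supercharge ζ L ψ) (supercharge ζ L ψ) =
      L * inner ℂ (split ζ ψ) (altSum (L + 1) (split ζ ψ)) := by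
  have hL' : (L : ℂ) + 1 ≠ 0 := by exact_mod_cast L.succ_ne_zero
  rw [supercharge_apply ζ hL, starProjection_of_mem h, inner_smul_left, inner_smul_right,
    inner_altSum_self, inner_altSum_comm L.succ_ne_zero, map_neg, Complex.conj_ofReal, ← mul_assoc,
    neg_mul_neg, sqrt_mul_self_complex]
  push_cast
  field_simp

theorem inner_adjoint_supercharge_self (ζ : ℝ) {L : ℕ} {ψ : Chain (L + 2)}
    (h : ψ ∈ altCyclic (L + 2)) :
    inner ℂ (LinearMap.adjoint (supercharge ζ (L + 1)) ψ)
        (LinearMap.adjoint (supercharge ζ (L + 1)) ψ) =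
      (L + 2) * inner ℂ (altSum (L + 1) (merge ζ ψ)) (merge ζ ψ) := by
  have hL : (L : ℂ) + 1 ≠ 0 := by exact_mod_cast L.succ_ne_zero
  have hL2 : (L : ℂ) + 1 + 1 ≠ 0 := by exact_mod_cast (L + 1).succ_ne_zero
  have hs := sqrt_mul_self_complex (L + 1)
  rw [adjoint_supercharge_of_mem ζ h, inner_smul_left, inner_smul_right, inner_altSum_self]
  simp only [map_mul, map_neg, Complex.conj_ofReal, map_div₀, map_add, Complex.conj_natCast, map_one,
    Complex.conj_ofNat]
  generalize ((Real.sqrt _ : ℝ) : ℂ) = r at hs ⊢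
  push_cast at hs ⊢
  field_simp at hs ⊢
  linear_combination (inner ℂ (altSum (L + 1) (merge ζ ψ)) (merge ζ ψ)) * (L + 2) * hs

theorem wordSum_two_blocks {N p q : ℕ} (h : N = 2 + (p + (2 + q))) (f : List (Fin 2) → ℂ) :
    wordSum N f = wordSum p fun X => wordSum q fun Y =>
      ∑ a : Fin 2, ∑ b : Fin 2, ∑ c : Fin 2, ∑ d : Fin 2, f (a :: b :: (X ++ c :: d :: Y)) := by
  rw [h, wordSum_add]
  simp only [wordSum_add p, wordSum_add 2 q]
  simp only [wordSum, wordSum_sum, List.cons_append, List.nil_append]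

theorem wordSum_two_letters {N p q : ℕ} (h : N = 1 + (p + (1 + q))) (f : List (Fin 2) → ℂ) :
    wordSum N f = wordSum p fun X => wordSum q fun Y =>
      ∑ a : Fin 2, ∑ b : Fin 2, f (a :: (X ++ b :: Y)) := by
  rw [h, wordSum_add]
  simp only [wordSum_add p, wordSum_add 1 q]
  simp only [wordSum, wordSum_sum, List.cons_append, List.nil_append]

theorem word_append_comm_of_odd {L : ℕ} (hL : Odd L) {ψ : Chain L} (h : ψ ∈ altCyclic L)
    (X Y : List (Fin 2)) : word L ψ (Y ++ X) = word L ψ (X ++ Y) := by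
  rw [word_append_comm h X Y, altSign_of_odd hL, one_pow, one_mul]

theorem rotate_append_cons {X Y : List (Fin 2)} {a : Fin 2} {k : ℕ} (h : X.length + 1 = k) :
    (a :: (X ++ Y)).rotate k = Y ++ a :: X := by
  rw [← h, ← List.length_cons (a := a), ← List.cons_append, List.rotate_append_length_eq]

theorem rotate_append_cons_cons {X Y : List (Fin 2)} {a b : Fin 2} {k : ℕ}
    (h : X.length + 2 = k) :
    (a :: b :: (X ++ Y)).rotate k = Y ++ a :: b :: X := by
  rw [← List.cons_append, rotate_append_cons (by simpa using h)]

/-- Local operators at disjoint places commute: splitting one site and then merging a disjoint pair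
equals merging first and splitting afterwards. The words X and Y are the two arcs separating the two
places; translation invariance of ψ identifies the resulting coordinates. -/
theorem inner_split_translation_pow (ζ : ℝ) {p q : ℕ} {ψ : Chain (p + q + 1 + 2)}
    (hodd : Odd (p + q + 1 + 2)) (h : ψ ∈ altCyclic (p + q + 1 + 2)) :
    inner ℂ (split ζ ψ) ((translation _ ^ (p + 2)) (split ζ ψ)) =
      inner ℂ ((translation _ ^ (p + 1)) (merge ζ ψ)) (merge ζ ψ) := by
  rw [inner_eq_wordSum, inner_eq_wordSum]
  simp only [word_translation_pow]
  rw [wordSum_two_blocks (show p + q + 1 + 2 + 1 = 2 + (p + (2 + q)) by omega),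
    wordSum_two_letters (show p + q + 1 + 1 = 1 + (p + (1 + q)) by omega)]
  refine wordSum_congr fun X hX => wordSum_congr fun Y hY => ?_
  have hc : ∀ (c d : Fin 2) (X Y : List (Fin 2)), word _ ψ (1 :: (X ++ c :: d :: Y)) =
      word _ ψ (c :: d :: (Y ++ 1 :: X)) := fun c d X Y => by
    have := word_append_comm_of_odd hodd h (c :: d :: Y) (1 :: X)
    simpa using this
  have hs : ∀ (a b c d : Fin 2) (X Y : List (Fin 2)) (h : X.length + Y.length = p + q),
      word (p + q + 1 + 2 + 1) (split ζ ψ) (a :: b :: (X ++ c :: d :: Y)) =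
      pairWeight ζ a b * word _ ψ (c :: d :: (Y ++ 1 :: X)) := fun a b c d X Y h => by
    rw [word_split _ _ _ _ _ (by simp; omega), hc]
  have hm : ∀ (b : Fin 2) (X Y : List (Fin 2)) (h : X.length + Y.length = p + q),
      word (p + q + 1 + 1) (merge ζ ψ) (1 :: (X ++ b :: Y)) =
      word _ ψ (0 :: 0 :: (X ++ b :: Y)) - ζ * word _ ψ (1 :: 1 :: (X ++ b :: Y)) :=
    fun b X Y h => by
    rw [word_merge_one _ _ _ (by simp; omega)]
  have hm0 : ∀ (b : Fin 2) (X Y : List (Fin 2)) (h : X.length + Y.length = p + q),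
      word (p + q + 1 + 1) (merge ζ ψ) (0 :: (X ++ b :: Y)) = 0 := fun b X Y h => by
    rw [word_merge_zero _ _ _ (by simp; omega)]
  have r2 : ∀ a b c d : Fin 2, (a :: b :: (X ++ c :: d :: Y)).rotate (p + 2) =
      c :: d :: (Y ++ a :: b :: X) := fun a b c d => by
    rw [rotate_append_cons_cons (by omega)]
    simp
  have r1 : ∀ a b : Fin 2, (a :: (X ++ b :: Y)).rotate (p + 1) = b :: (Y ++ a :: X) :=
    fun a b => by
    rw [rotate_append_cons (by omega)]
    simp
  have l1 : X.length + Y.length = p + q := by omega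
  have l2 : Y.length + X.length = p + q := by omega
  simp only [Fin.sum_univ_two, r1, r2, hs _ _ _ _ _ _ l1, hs _ _ _ _ _ _ l2, hm _ _ _ l1,
    hm _ _ _ l2, hm0 _ _ _ l1, hm0 _ _ _ l2]
  simp
  ring

theorem inner_translation_pow_pred {N : ℕ} (x : Chain (N + 1)) :
    inner ℂ x ((translation (N + 1) ^ N) x) = inner ℂ (translation (N + 1) x) x := by
  have h : translation (N + 1) ((translation (N + 1) ^ N) x) = x := by
    rw [← Module.End.mul_apply, ← pow_succ', translation_pow_self]
    rfl
  rw [← inner_translation, h]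

/-- Rotation k + 2 in the split sum and rotation k + 1 in the merge sum contribute equal terms with
opposite signs. Only overlapping positions survive: rotations 0 and ±1 for `split`, and rotation 0
for `merge`. -/
theorem inner_altSum_split_add (ζ : ℝ) {L : ℕ} {ψ : Chain (L + 2)}
    (hodd : Odd (L + 2)) (h : ψ ∈ altCyclic (L + 2)) :
    inner ℂ (split ζ ψ) (altSum (L + 3) (split ζ ψ)) +
        inner ℂ (altSum (L + 1) (merge ζ ψ)) (merge ζ ψ) =
      inner ℂ (split ζ ψ) (split ζ ψ) - inner ℂ (split ζ ψ) (translation _ (split ζ ψ)) -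
        inner ℂ (translation _ (split ζ ψ)) (split ζ ψ) + inner ℂ (merge ζ ψ) (merge ζ ψ) := by
  have h3 : altSign (L + 3) = -1 := altSign_of_even (by grind)
  have h1 : altSign (L + 1) = -1 := altSign_of_even (by grind)
  have hp : (-1 : ℂ) ^ (L + 2) = -1 := hodd.neg_one_pow
  have hk : ∀ k ∈ Finset.range L,
      inner ℂ (split ζ ψ) ((translation _ ^ (k + 1 + 1)) (split ζ ψ)) =
      inner ℂ ((translation _ ^ (k + 1)) (merge ζ ψ)) (merge ζ ψ) := fun k hk => by
    obtain ⟨q, rfl⟩ := Nat.exists_eq_add_of_lt (Finset.mem_range.1 hk)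
    exact inner_split_translation_pow ζ hodd h
  simp only [altSum_apply, sum_inner, inner_sum, inner_smul_left, inner_smul_right, h3, h1,
    map_pow, map_neg, map_one]
  rw [Finset.sum_range_succ, inner_translation_pow_pred, hp, Finset.sum_range_succ',
    Finset.sum_range_succ', Finset.sum_range_succ' _ L]
  rw [Finset.sum_congr rfl fun k hk' => by rw [hk k hk']]
  simp only [pow_succ, mul_neg, neg_mul, mul_one, neg_neg, Finset.sum_neg_distrib, pow_zero,
    one_mul, Module.End.one_apply]
  ring

/-- The expectation value density of the bond Hamiltonian on the first two sites, shifted by the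
ground state energy per site. -/
def bondDensity (ζ : ℝ) (f : List (Fin 2) → ℂ) (Z : List (Fin 2)) : ℂ :=
  conj (f (0 :: 0 :: Z)) * f (0 :: 0 :: Z) + conj (f (1 :: 1 :: Z)) * f (1 :: 1 :: Z) +
    (1 + ζ ^ 2) / 2 * (conj (f (0 :: 1 :: Z)) * f (0 :: 1 :: Z) +
      conj (f (1 :: 0 :: Z)) * f (1 :: 0 :: Z)) -
    (conj (f (0 :: 1 :: Z)) * f (1 :: 0 :: Z) + conj (f (1 :: 0 :: Z)) * f (0 :: 1 :: Z)) -
    ζ * (conj (f (0 :: 0 :: Z)) * f (1 :: 1 :: Z) + conj (f (1 :: 1 :: Z)) * f (0 :: 0 :: Z))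

theorem inner_split_split (ζ : ℝ) {L : ℕ} (ψ : Chain (L + 2)) :
    inner ℂ (split ζ ψ) (split ζ ψ) = wordSum L fun Z => (1 + ζ ^ 2) *
      (conj (word _ ψ (1 :: 0 :: Z)) * word _ ψ (1 :: 0 :: Z) +
        conj (word _ ψ (1 :: 1 :: Z)) * word _ ψ (1 :: 1 :: Z)) := by
  rw [inner_eq_wordSum]
  simp only [wordSum, ← wordSum_plus, Fin.sum_univ_two]
  refine wordSum_congr fun X hX => ?_
  have hs : ∀ a b c : Fin 2, word (L + 2 + 1) (split ζ ψ) (a :: b :: c :: X) =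
      pairWeight ζ a b * word _ ψ (1 :: c :: X) := fun a b c =>
    word_split _ _ _ _ _ (by simp; omega)
  simp only [hs]
  simp
  ring

theorem inner_split_translation (ζ : ℝ) {L : ℕ} {ψ : Chain (L + 2)}
    (hodd : Odd (L + 2)) (h : ψ ∈ altCyclic (L + 2)) :
    inner ℂ (split ζ ψ) (translation _ (split ζ ψ)) = wordSum L fun Z =>
      conj (word _ ψ (1 :: 0 :: Z)) * word _ ψ (0 :: 1 :: Z) +
        ζ ^ 2 * (conj (word _ ψ (1 :: 1 :: Z)) * word _ ψ (1 :: 1 :: Z)) := by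
  rw [inner_eq_wordSum]
  simp only [wordSum, ← wordSum_plus, Fin.sum_univ_two]
  refine wordSum_congr fun X hX => ?_
  have hs : ∀ a b c : Fin 2, word (L + 2 + 1) (split ζ ψ) (a :: b :: c :: X) =
      pairWeight ζ a b * word _ ψ (1 :: c :: X) := fun a b c =>
    word_split _ _ _ _ _ (by simp; omega)
  have ht : ∀ a b c : Fin 2, word (L + 2 + 1) (translation _ (split ζ ψ)) (a :: b :: c :: X) =
      pairWeight ζ b c * word _ ψ (a :: 1 :: X) := fun a b c => by
    have h1 : (a :: b :: c :: X).rotate 1 = b :: c :: (X ++ [a]) := by simp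
    have h2 := word_append_comm_of_odd hodd h [a] (1 :: X)
    rw [word_translation, h1, word_split _ _ _ _ _ (by simp; omega)]
    rw [List.cons_append] at h2
    rw [h2]
    rfl
  simp only [hs, ht]
  simp
  ring

theorem inner_merge_merge (ζ : ℝ) {L : ℕ} (ψ : Chain (L + 2)) :
    inner ℂ (merge ζ ψ) (merge ζ ψ) = wordSum L fun Z =>
      conj (word _ ψ (0 :: 0 :: Z) - ζ * word _ ψ (1 :: 1 :: Z)) *
        (word _ ψ (0 :: 0 :: Z) - ζ * word _ ψ (1 :: 1 :: Z)) := by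
  rw [inner_eq_wordSum]
  simp only [wordSum, ← wordSum_plus, Fin.sum_univ_two]
  refine wordSum_congr fun X hX => ?_
  rw [word_merge_zero _ _ _ (by omega), word_merge_one _ _ _ (by omega)]
  simp

/-- By translation invariance, the weight of a spin down is the same at the first and the second
site. Removing the weight of two spins down from both sides leaves the claim. -/
theorem wordSum_swap {L : ℕ} {ψ : Chain (L + 2)}
    (hodd : Odd (L + 2)) (h : ψ ∈ altCyclic (L + 2)) :
    (wordSum L fun Z => conj (word _ ψ (0 :: 1 :: Z)) * word _ ψ (0 :: 1 :: Z)) =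
      wordSum L fun Z => conj (word _ ψ (1 :: 0 :: Z)) * word _ ψ (1 :: 0 :: Z) := by
  have h1 : (wordSum (L + 1) fun Z => conj (word _ ψ (1 :: Z)) * word _ ψ (1 :: Z)) =
      ∑ a : Fin 2, wordSum L fun Z => conj (word _ ψ (a :: 1 :: Z)) * word _ ψ (a :: 1 :: Z) := by
    rw [wordSum_succ_last]
    refine Finset.sum_congr rfl fun a _ => wordSum_congr fun X _ => ?_
    have h2 := word_append_comm_of_odd hodd h [a] (1 :: X)
    rw [List.cons_append] at h2
    rw [h2]
    rfl
  simp only [wordSum, Fin.sum_univ_two] at h1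
  linear_combination -h1

theorem inner_supercharge_add (ζ : ℝ) {L : ℕ} {ψ : Chain (L + 2)}
    (hodd : Odd (L + 2)) (h : ψ ∈ altCyclic (L + 2)) :
    inner ℂ (supercharge ζ (L + 2) ψ) (supercharge ζ (L + 2) ψ) +
      inner ℂ (LinearMap.adjoint (supercharge ζ (L + 1)) ψ)
        (LinearMap.adjoint (supercharge ζ (L + 1)) ψ) =
      (L + 2) * wordSum L (bondDensity ζ (word _ ψ)) := by
  have hs := wordSum_swap hodd h
  rw [inner_supercharge_self ζ (by omega) h, inner_adjoint_supercharge_self ζ h]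
  push_cast
  rw [← mul_add, inner_altSum_split_add ζ hodd h,
    ← inner_conj_symm (translation _ (split ζ ψ)), inner_split_translation ζ hodd h,
    inner_split_split, inner_merge_merge]
  congr 1
  have hc : ∀ (m : ℕ) (f : List (Fin 2) → ℂ), conj (wordSum m f) =
      wordSum m fun l => conj (f l) := fun m f => by
    simp [← sum_ofFn]
  -- The expansion gives the weight 1 + ζ² to ↓↑ and none to ↑↓, whereas the bond density shares it
  -- equally. The discrepancy sums to zero.
  have hz : wordSum L (fun Z => (1 + ζ ^ 2) / 2 *
      (conj (word _ ψ (0 :: 1 :: Z)) * word _ ψ (0 :: 1 :: Z) -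
        conj (word _ ψ (1 :: 0 :: Z)) * word _ ψ (1 :: 0 :: Z))) = 0 := by
    rw [wordSum_mul, wordSum_sub, hs, sub_self, mul_zero]
  rw [← sub_eq_zero, ← neg_eq_zero, ← hz, hc, ← wordSum_sub, ← wordSum_sub, ← wordSum_plus,
    ← wordSum_sub, neg_eq_iff_eq_neg, ← neg_one_mul (wordSum L _), ← wordSum_mul]
  refine wordSum_congr fun Z _ => ?_
  simp only [bondDensity, map_add, map_mul, Complex.conj_conj, map_sub, map_pow,
    Complex.conj_ofReal]
  ring

/-! ### The shifted XYZ Hamiltonian as a sum of two-site operators -/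

/-- The configuration with the spins at the sites `i` and `j` reversed. -/
def flipPair {L : ℕ} (i j : Fin L) (s : Fin L → Fin 2) : Fin L → Fin 2 :=
  Function.update (Function.update s i (1 - s i)) j (1 - s j)

theorem flipPair_apply_left {L : ℕ} {i j : Fin L} (h : i ≠ j) (s : Fin L → Fin 2) :
    flipPair i j s i = 1 - s i := by
  simp [flipPair, Function.update_of_ne h]

theorem flipPair_apply_right {L : ℕ} (i j : Fin L) (s : Fin L → Fin 2) :
    flipPair i j s j = 1 - s j := by
  simp [flipPair]

theorem flipPair_apply_of_ne {L : ℕ} {i j k : Fin L} (hi : k ≠ i) (hj : k ≠ j)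
    (s : Fin L → Fin 2) : flipPair i j s k = s k := by
  simp [flipPair, Function.update_of_ne, hi, hj]

theorem one_sub_one_sub_fin_two (a : Fin 2) : 1 - (1 - a) = a := by
  fin_cases a <;> rfl

theorem flipPair_involutive {L : ℕ} {i j : Fin L} (h : i ≠ j) :
    Function.Involutive (flipPair i j) := by
  intro s
  funext k
  by_cases hj : k = j
  · subst hj
    rw [flipPair_apply_right, flipPair_apply_right, one_sub_one_sub_fin_two]
  by_cases hi : k = i
  · subst hi
    rw [flipPair_apply_left h, flipPair_apply_left h, one_sub_one_sub_fin_two]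
  rw [flipPair_apply_of_ne hi hj, flipPair_apply_of_ne hi hj]

theorem sum_flipPair {L : ℕ} {i j : Fin L} (h : i ≠ j) {M : Type*} [AddCommMonoid M]
    (f : (Fin L → Fin 2) → M) : ∑ s, f (flipPair i j s) = ∑ s, f s :=
  Equiv.sum_comp (flipPair_involutive h).toPerm f

/-- The diagonal matrix elements of the shifted two-site Hamiltonian. -/
def bondDiag (ζ : ℝ) (a b : Fin 2) : ℝ := if a = b then 1 else (1 + ζ ^ 2) / 2

/-- The negatives of the off-diagonal matrix elements of the two-site Hamiltonian. -/
def bondOff (ζ : ℝ) (a b : Fin 2) : ℝ := if a = b then ζ else 1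

/-- The two-site Hamiltonian for the sites `i` and `j`, shifted by the ground-state energy per
site. -/
def bondOp (ζ : ℝ) {L : ℕ} (i j : Fin L) : Chain L →ₗ[ℂ] Chain L :=
  (((3 + ζ ^ 2) / 4 : ℝ) : ℂ) • 1 + (-(1 / 2) : ℂ) •
    (((1 + ζ : ℝ) : ℂ) • (siteOp pauliX i ∘ₗ siteOp pauliX j) +
     ((1 - ζ : ℝ) : ℂ) • (siteOp pauliY i ∘ₗ siteOp pauliY j) +
     (((ζ ^ 2 - 1) / 2 : ℝ) : ℂ) • (siteOp pauliZ i ∘ₗ siteOp pauliZ j))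

theorem siteOp_siteOp_apply {L : ℕ} (A B : Matrix (Fin 2) (Fin 2) ℂ) {i j : Fin L} (h : i ≠ j)
    (ψ : Chain L) (s : Fin L → Fin 2) :
    siteOp A i (siteOp B j ψ) s = ∑ t : Fin 2, A (s i) t * ∑ t' : Fin 2, B (s j) t' *
      ψ (Function.update (Function.update s i t) j t') := by
  simp only [siteOp, LinearMap.coe_mk, AddHom.coe_mk, Function.update_of_ne h.symm]

theorem bondOp_apply (ζ : ℝ) {L : ℕ} {i j : Fin L} (h : i ≠ j) (ψ : Chain L)
    (s : Fin L → Fin 2) : bondOp ζ i j ψ s =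
      bondDiag ζ (s i) (s j) * ψ s - bondOff ζ (s i) (s j) * ψ (flipPair i j s) := by
  have hu : ∀ a b, s i = a → s j = b →
      Function.update (Function.update s i a) j b = s := by
    rintro a b rfl rfl
    simp
  simp only [bondOp, LinearMap.add_apply, LinearMap.smul_apply, LinearMap.comp_apply,
    Module.End.one_apply, PiLp.add_apply, PiLp.smul_apply, siteOp_siteOp_apply _ _ h,
    Fin.sum_univ_two, smul_eq_mul, flipPair]
  have h2 : ∀ a : Fin 2, a = 0 ∨ a = 1 := by decide
  rcases h2 (s i) with hi | hi <;> rcases h2 (s j) with hj | hj <;>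
    simp [hi, hj, pauliX, pauliY, pauliZ, bondDiag, bondOff, hu _ _ hi hj] <;>
    ring_nf <;> simp <;> ring

theorem translation_siteOp {L : ℕ} (A : Matrix (Fin 2) (Fin 2) ℂ) (i : Fin L) (ψ : Chain L) :
    translation L (siteOp A i ψ) = siteOp A (finRotate L i) (translation L ψ) := by
  ext s
  simp only [translation, siteOp, LinearMap.coe_mk, AddHom.coe_mk]
  refine Finset.sum_congr rfl fun t _ => ?_
  exact congrArg (fun r => A (s (finRotate L i)) t * ψ r)
    (Function.update_comp_eq_of_injective s (finRotate L).injective i t).symm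

theorem translation_bondOp (ζ : ℝ) {L : ℕ} (i j : Fin L) (ψ : Chain L) :
    translation L (bondOp ζ i j ψ) =
      bondOp ζ (finRotate L i) (finRotate L j) (translation L ψ) := by
  simp [bondOp, translation_siteOp]

/-- The XYZ Hamiltonian, shifted by the ground-state energy. -/
def shiftedXYZ (L : ℕ) (ζ : ℝ) : Chain L →ₗ[ℂ] Chain L :=
  ∑ j : Fin L, bondOp ζ j (finRotate L j)

theorem shiftedXYZ_eq (L : ℕ) (ζ : ℝ) :
    shiftedXYZ L ζ = susyXYZ L ζ + (((L : ℝ) * (3 + ζ ^ 2) / 4 : ℝ) : ℂ) • 1 := by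
  have h : ∀ f g : Fin L → (Chain L →ₗ[ℂ] Chain L), ∑ j, (f j + g j) = ∑ j, g j + ∑ j, f j :=
    fun f g => by rw [Finset.sum_add_distrib, add_comm]
  simp only [shiftedXYZ, bondOp, h, susyXYZ, xyzHamiltonian, ← Finset.smul_sum]
  congr 1
  rw [Finset.sum_const, Finset.card_univ, Fintype.card_fin, ← Nat.cast_smul_eq_nsmul ℂ, smul_smul]
  push_cast
  ring_nf

theorem translation_shiftedXYZ (ζ : ℝ) {L : ℕ} (ψ : Chain L) :
    translation L (shiftedXYZ L ζ ψ) = shiftedXYZ L ζ (translation L ψ) := by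
  simp only [shiftedXYZ, LinearMap.sum_apply, map_sum, translation_bondOp]
  exact Equiv.sum_comp (finRotate L) fun j => bondOp ζ j (finRotate L j) (translation L ψ)

theorem ne_finRotate {L : ℕ} (hL : 2 ≤ L) (j : Fin L) : j ≠ finRotate L j := by
  obtain ⟨m, rfl⟩ := Nat.exists_eq_add_of_le' hL
  rw [finRotate_apply]
  simp

theorem isSymmetric_bondOp (ζ : ℝ) {L : ℕ} {i j : Fin L} (h : i ≠ j) :
    (bondOp ζ i j).IsSymmetric := by
  intro φ ψ
  have ho : ∀ s : Fin L → Fin 2, bondOff ζ (flipPair i j s i) (flipPair i j s j) =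
      bondOff ζ (s i) (s j) := fun s => by
    rw [flipPair_apply_left h, flipPair_apply_right]
    generalize s i = a
    generalize s j = b
    fin_cases a <;> fin_cases b <;> rfl
  have hs := sum_flipPair h fun s => (bondOff ζ (s i) (s j) : ℂ) * (conj (φ (flipPair i j s)) * ψ s)
  simp only [ho, flipPair_involutive h _] at hs
  simp only [PiLp.inner_apply, bondOp_apply ζ h, RCLike.inner_apply, map_sub, map_mul,
    Complex.conj_ofReal, sub_mul, mul_sub, Finset.sum_sub_distrib]
  congr 1
  · exact Finset.sum_congr rfl fun s _ => by ring
  · refine Eq.trans (Finset.sum_congr rfl fun s _ => ?_) (hs.symm.trans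
      (Finset.sum_congr rfl fun s _ => ?_)) <;> ring

theorem isSymmetric_shiftedXYZ (ζ : ℝ) {L : ℕ} (hL : 2 ≤ L) : (shiftedXYZ L ζ).IsSymmetric := by
  intro φ ψ
  simp only [shiftedXYZ, LinearMap.sum_apply, sum_inner, inner_sum]
  exact Finset.sum_congr rfl fun j _ => isSymmetric_bondOp ζ (ne_finRotate hL j) φ ψ

theorem inner_bondOp_first (ζ : ℝ) {L : ℕ} (ψ : Chain (L + 2)) :
    inner ℂ ψ (bondOp ζ 0 1 ψ) = wordSum L (bondDensity ζ (word _ ψ)) := by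
  have hw : ∀ (a b : Fin 2) (Z : List (Fin 2)), Z.length = L →
      word _ (bondOp ζ 0 1 ψ) (a :: b :: Z) = bondDiag ζ a b * word _ ψ (a :: b :: Z) -
        bondOff ζ a b * word _ ψ ((1 - a) :: (1 - b) :: Z) := fun a b Z hZ => by
    have hl : ∀ a b : Fin 2, (a :: b :: Z).length = L + 2 := by simp [hZ]
    rw [word_apply _ _ (hl _ _), word_apply _ _ (hl _ _), word_apply _ _ (hl _ _),
      bondOp_apply ζ (by simp)]
    have hf : flipPair 0 1 (fun i : Fin (L + 2) => (a :: b :: Z).get (i.cast (hl a b).symm)) =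
        fun i => ((1 - a) :: (1 - b) :: Z).get (i.cast (hl (1 - a) (1 - b)).symm) := ?_
    · rw [hf]
      rfl
    funext i
    refine Fin.cases ?_ (fun i => Fin.cases ?_ (fun i => ?_) i) i
    · rw [flipPair_apply_left (by simp)]
      rfl
    · exact flipPair_apply_right _ _ _
    · rw [flipPair_apply_of_ne (by simp) (by simp [Fin.ext_iff])]
      rfl
  rw [inner_eq_wordSum]
  simp only [wordSum, ← wordSum_plus, Fin.sum_univ_two]
  refine wordSum_congr fun Z hZ => ?_
  simp only [hw _ _ _ hZ]
  simp [bondDiag, bondOff, bondDensity]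
  ring

/-- For odd length the alternate-cyclic states are translation invariant, so all bonds have the same
expectation value as the first one. -/
theorem inner_shiftedXYZ_of_mem (ζ : ℝ) {L : ℕ} {ψ : Chain (L + 2)} (hodd : Odd (L + 2))
    (h : ψ ∈ altCyclic (L + 2)) :
    inner ℂ ψ (shiftedXYZ _ ζ ψ) = (L + 2) * wordSum L (bondDensity ζ (word _ ψ)) := by
  have hT : translation _ ψ = ψ := by
    rw [mem_altCyclic.1 h, altSign_of_odd hodd, one_smul]
  have h1 : ∀ j : Fin (L + 2), inner ℂ ψ (bondOp ζ (j + 1) (j + 1 + 1) ψ) =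
      inner ℂ ψ (bondOp ζ j (j + 1) ψ) := fun j => by
    have := translation_bondOp ζ j (j + 1) ψ
    rw [hT, finRotate_apply, finRotate_apply] at this
    rw [← this]
    nth_rw 1 [← hT]
    rw [inner_translation]
  have h2 : ∀ j : Fin (L + 2), inner ℂ ψ (bondOp ζ j (j + 1) ψ) =
      wordSum L (bondDensity ζ (word _ ψ)) := fun j => by
    induction j using Fin.induction with
    | zero => rw [zero_add, inner_bondOp_first]
    | succ i ih =>
      rw [← Fin.coeSucc_eq_succ, h1, ih]
  simp [shiftedXYZ, h2]

theorem inner_shiftedXYZ_eq_supercharge (ζ : ℝ) {L : ℕ} {ψ : Chain (L + 2)} (hodd : Odd (L + 2))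
    (h : ψ ∈ altCyclic (L + 2)) :
    inner ℂ ψ (shiftedXYZ _ ζ ψ) =
      inner ℂ (supercharge ζ (L + 2) ψ) (supercharge ζ (L + 2) ψ) +
      inner ℂ (LinearMap.adjoint (supercharge ζ (L + 1)) ψ)
        (LinearMap.adjoint (supercharge ζ (L + 1)) ψ) := by
  rw [inner_supercharge_add ζ hodd h, inner_shiftedXYZ_of_mem ζ hodd h]

/-! ### Perron–Frobenius: the sign gauge and the vector of moduli -/

theorem numDown_eq_sum {L : ℕ} (s : Fin L → Fin 2) : numDown s = ∑ k, (s k : ℕ) := by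
  rw [numDown, Finset.card_filter]
  refine Finset.sum_congr rfl fun k _ => ?_
  generalize s k = a
  fin_cases a <;> rfl

theorem numDown_update {L : ℕ} (s : Fin L → Fin 2) (i : Fin L) (a : Fin 2) :
    numDown (Function.update s i a) + s i = numDown s + a := by
  have h : ∀ t : Fin L → Fin 2, (t i : ℕ) + ∑ k ∈ Finset.univ.erase i, (t k : ℕ) = numDown t :=
    fun t => by rw [numDown_eq_sum, Finset.add_sum_erase _ (fun k => (t k : ℕ)) (Finset.mem_univ i)]
  rw [← h s, ← h (Function.update s i a), Function.update_self,
    Finset.sum_congr rfl fun k hk => by rw [Function.update_of_ne (Finset.ne_of_mem_erase hk)]]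
  omega

theorem numDown_flipPair {L : ℕ} {i j : Fin L} (h : i ≠ j) (s : Fin L → Fin 2) :
    numDown (flipPair i j s) + s i + s j = numDown s + (1 - s i : Fin 2) + (1 - s j : Fin 2) := by
  have h1 := numDown_update s i (1 - s i)
  have h2 := numDown_update (Function.update s i (1 - s i)) j (1 - s j)
  rw [Function.update_of_ne h.symm] at h2
  rw [flipPair]
  omega

/-- The diagonal sign change after which the XYZ Hamiltonian has non-positive off-diagonal
matrix elements. -/
def gaugeSign (ζ : ℝ) {L : ℕ} (s : Fin L → Fin 2) : ℝ :=
  (if 0 < ζ then 1 else -1) ^ (numDown s / 2)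

theorem gaugeSign_mul_self (ζ : ℝ) {L : ℕ} (s : Fin L → Fin 2) :
    gaugeSign ζ s * gaugeSign ζ s = 1 := by
  rw [gaugeSign, ← mul_pow]
  split_ifs <;> simp

/-- Reversing antiparallel spins keeps the number d of spins down and has amplitude 1. Reversing
parallel spins changes d / 2 by exactly one, so the gauge picks up the sign of ζ, which is the sign
of the amplitude. -/
theorem bondOff_mul_gaugeSign (ζ : ℝ) {L : ℕ} {i j : Fin L} (h : i ≠ j) (s : Fin L → Fin 2) :
    bondOff ζ (s i) (s j) * gaugeSign ζ (flipPair i j s) =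
      |bondOff ζ (s i) (s j)| * gaugeSign ζ s := by
  have hd := numDown_flipPair h s
  have key : ∀ m : ℕ, ζ * (if 0 < ζ then (1 : ℝ) else -1) ^ m =
      |ζ| * (if 0 < ζ then (1 : ℝ) else -1) ^ (m + 1) := fun m => by
    split_ifs with hz
    · simp [abs_of_pos hz]
    · rw [abs_of_nonpos (not_lt.1 hz), pow_succ]
      ring
  have key' : ∀ m : ℕ, ζ * (if 0 < ζ then (1 : ℝ) else -1) ^ (m + 1) =
      |ζ| * (if 0 < ζ then (1 : ℝ) else -1) ^ m := fun m => by
    rw [key, pow_add, pow_add]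
    split_ifs <;> simp
  have h2 : ∀ a : Fin 2, a = 0 ∨ a = 1 := by decide
  rcases h2 (s i) with hi | hi <;> rcases h2 (s j) with hj | hj <;> rw [hi, hj] at hd ⊢ <;>
    rw [gaugeSign, gaugeSign] <;> generalize (if 0 < ζ then (1 : ℝ) else -1) = r at key key' ⊢ <;>
    simp [bondOff] at hd ⊢
  · rw [show numDown (flipPair i j s) / 2 = numDown s / 2 + 1 by omega, key']
  · rw [show numDown (flipPair i j s) = numDown s by omega]
  · rw [show numDown (flipPair i j s) = numDown s by omega]
  · rw [show numDown s / 2 = numDown (flipPair i j s) / 2 + 1 by omega, key]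

/-- The state with the same moduli as `ψ` and with the signs of the gauge. -/
def gaugedAbs (ζ : ℝ) {L : ℕ} (ψ : Chain L) : Chain L :=
  WithLp.toLp 2 fun s => ((gaugeSign ζ s * ‖ψ s‖ : ℝ) : ℂ)

theorem gaugedAbs_apply (ζ : ℝ) {L : ℕ} (ψ : Chain L) (s : Fin L → Fin 2) :
    gaugedAbs ζ ψ s = ((gaugeSign ζ s * ‖ψ s‖ : ℝ) : ℂ) := rfl

theorem norm_gaugedAbs_apply (ζ : ℝ) {L : ℕ} (ψ : Chain L) (s : Fin L → Fin 2) :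
    ‖gaugedAbs ζ ψ s‖ = ‖ψ s‖ := by
  have : |gaugeSign ζ s| = 1 := by
    rw [← abs_one, ← sq_eq_sq_iff_abs_eq_abs, sq, gaugeSign_mul_self, one_pow]
  rw [gaugedAbs_apply, Complex.norm_real, norm_mul, Real.norm_eq_abs, this, one_mul, norm_norm]

theorem norm_gaugedAbs (ζ : ℝ) {L : ℕ} (ψ : Chain L) : ‖gaugedAbs ζ ψ‖ = ‖ψ‖ := by
  simp only [EuclideanSpace.norm_eq, norm_gaugedAbs_apply]

theorem re_inner_bondOp (ζ : ℝ) {L : ℕ} {i j : Fin L} (h : i ≠ j) (ψ : Chain L) :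
    (inner ℂ ψ (bondOp ζ i j ψ)).re = ∑ s, (bondDiag ζ (s i) (s j) * ‖ψ s‖ ^ 2 -
      bondOff ζ (s i) (s j) * (conj (ψ s) * ψ (flipPair i j s)).re) := by
  rw [PiLp.inner_apply, Complex.re_sum]
  refine Finset.sum_congr rfl fun s _ => ?_
  rw [bondOp_apply ζ h, RCLike.inner_apply]
  have h1 : (bondDiag ζ (s i) (s j) * ψ s - bondOff ζ (s i) (s j) * ψ (flipPair i j s)) *
      conj (ψ s) = bondDiag ζ (s i) (s j) * (conj (ψ s) * ψ s) -
        bondOff ζ (s i) (s j) * (conj (ψ s) * ψ (flipPair i j s)) := by ring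
  rw [h1, Complex.sub_re, Complex.re_ofReal_mul, Complex.re_ofReal_mul, ← Complex.normSq_eq_conj_mul_self,
    Complex.ofReal_re, Complex.normSq_eq_norm_sq]

/-- Diagonal terms depend only on moduli. In each off-diagonal term the gauge turns the amplitude
into its modulus, which is the largest value it can contribute to the subtracted part. -/
theorem re_inner_bondOp_gaugedAbs_le (ζ : ℝ) {L : ℕ} {i j : Fin L} (h : i ≠ j) (ψ : Chain L) :
    (inner ℂ (gaugedAbs ζ ψ) (bondOp ζ i j (gaugedAbs ζ ψ))).re ≤
      (inner ℂ ψ (bondOp ζ i j ψ)).re := by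
  rw [re_inner_bondOp ζ h, re_inner_bondOp ζ h]
  refine Finset.sum_le_sum fun s _ => ?_
  rw [norm_gaugedAbs_apply]
  refine sub_le_sub_left ?_ _
  have h1 : bondOff ζ (s i) (s j) *
      (conj (gaugedAbs ζ ψ s) * gaugedAbs ζ ψ (flipPair i j s)).re =
      |bondOff ζ (s i) (s j)| * (‖ψ s‖ * ‖ψ (flipPair i j s)‖) := by
    rw [gaugedAbs_apply, gaugedAbs_apply, Complex.conj_ofReal, ← Complex.ofReal_mul,
      Complex.ofReal_re]
    linear_combination (gaugeSign ζ s * ‖ψ s‖ * ‖ψ (flipPair i j s)‖) * bondOff_mul_gaugeSign ζ h s +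
      |bondOff ζ (s i) (s j)| * (‖ψ s‖ * ‖ψ (flipPair i j s)‖) * gaugeSign_mul_self ζ s
  rw [h1]
  refine (le_abs_self _).trans ?_
  rw [abs_mul]
  refine mul_le_mul_of_nonneg_left ?_ (abs_nonneg _)
  refine (Complex.abs_re_le_norm _).trans ?_
  rw [norm_mul, Complex.norm_conj]

theorem re_inner_shiftedXYZ_gaugedAbs_le (ζ : ℝ) {L : ℕ} (hL : 2 ≤ L) (ψ : Chain L) :
    (inner ℂ (gaugedAbs ζ ψ) (shiftedXYZ L ζ (gaugedAbs ζ ψ))).re ≤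
      (inner ℂ ψ (shiftedXYZ L ζ ψ)).re := by
  simp only [shiftedXYZ, LinearMap.sum_apply, inner_sum, Complex.re_sum]
  exact Finset.sum_le_sum fun j _ => re_inner_bondOp_gaugedAbs_le ζ (ne_finRotate hL j) ψ

/-! ### Variational principle and non-negativity on the whole space -/

/-- A minimizer of a quadratic form bounded below by `μ ‖x‖ ^ 2` is an eigenvector. -/
theorem apply_eq_of_re_inner_eq {E : Type*} [NormedAddCommGroup E] [InnerProductSpace ℂ E]
    {T : E →ₗ[ℂ] E} (hT : T.IsSymmetric) {μ : ℝ}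
    (hμ : ∀ x, μ * ‖x‖ ^ 2 ≤ (inner ℂ x (T x)).re) {v : E}
    (hv : (inner ℂ v (T v)).re ≤ μ * ‖v‖ ^ 2) : T v = (μ : ℂ) • v := by
  set w : E := T v - (μ : ℂ) • v with hw
  by_contra hne
  have hw0 : 0 < ‖w‖ ^ 2 := by
    have : w ≠ 0 := fun h => hne (sub_eq_zero.1 h)
    positivity
  set c : ℝ := (inner ℂ w (T w)).re - μ * ‖w‖ ^ 2 with hc
  have hn : ∀ x : E, (inner ℂ x x).re = ‖x‖ ^ 2 := fun x => by
    rw [inner_self_eq_norm_sq_to_K]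
    norm_cast
  have hB : ∀ t : ℝ, 0 ≤ -2 * t * ‖w‖ ^ 2 + t ^ 2 * c := fun t => by
    have h1 := hμ (v - (t : ℂ) • w)
    have h2 : inner ℂ w (T v) = inner ℂ w w + μ * inner ℂ w v := by
      rw [hw]; nth_rw 2 3 [← hw]
      rw [← inner_smul_right, ← inner_add_right]
      congr 1
      rw [hw]; abel
    have h3 : inner ℂ v (T w) = inner ℂ w w + μ * inner ℂ v w := by
      rw [← hT v w, ← inner_conj_symm, h2]
      simp
    rw [← hn] at h1 hv hc ⊢
    simp only [map_sub, map_smul, inner_sub_left, inner_sub_right, inner_smul_left,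
      inner_smul_right, Complex.conj_ofReal, Complex.sub_re, h2, h3, Complex.re_ofReal_mul,
      Complex.add_re] at h1 hv hc ⊢
    nlinarith
  -- Moving v against the residual w changes the form to first order by -2t‖w‖². This t is small
  -- enough for the quadratic term t²c not to compensate, whatever the sign and size of c.
  have h1 := hB (‖w‖ ^ 2 / (|c| + ‖w‖ ^ 2))
  have h2 : 0 < |c| + ‖w‖ ^ 2 := by positivity
  have h3 : -2 * (‖w‖ ^ 2 / (|c| + ‖w‖ ^ 2)) * ‖w‖ ^ 2 + (‖w‖ ^ 2 / (|c| + ‖w‖ ^ 2)) ^ 2 * c =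
      (‖w‖ ^ 2 / (|c| + ‖w‖ ^ 2)) ^ 2 * (c - 2 * (|c| + ‖w‖ ^ 2)) := by
    field_simp
    ring
  rw [h3] at h1
  have h4 : c - 2 * (|c| + ‖w‖ ^ 2) < 0 := by
    have := le_abs_self c
    have := abs_nonneg c
    linarith
  have h5 : 0 < (‖w‖ ^ 2 / (|c| + ‖w‖ ^ 2)) ^ 2 := by positivity
  nlinarith

theorem exists_minimizer {E : Type*} [NormedAddCommGroup E] [InnerProductSpace ℂ E]
    [FiniteDimensional ℂ E] [Nontrivial E] (T : E →ₗ[ℂ] E) :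
    ∃ (μ : ℝ) (v : E), v ≠ 0 ∧ (∀ x, μ * ‖x‖ ^ 2 ≤ (inner ℂ x (T x)).re) ∧
      (inner ℂ v (T v)).re = μ * ‖v‖ ^ 2 := by
  have : ProperSpace E := FiniteDimensional.proper_rclike ℂ E
  have hcont : Continuous fun x : E => (inner ℂ x (T x)).re := by
    have : Continuous T := T.continuous_of_finiteDimensional
    fun_prop
  obtain ⟨v, hv, hmin⟩ := (isCompact_sphere (0 : E) 1).exists_isMinOn
    (NormedSpace.sphere_nonempty.2 zero_le_one) hcont.continuousOn
  have hv1 : ‖v‖ = 1 := by simpa using hv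
  refine ⟨(inner ℂ v (T v)).re, v, fun h => by simp [h] at hv1, fun x => ?_, by simp [hv1]⟩
  rcases eq_or_ne x 0 with rfl | hx
  · simp
  have hx' : ‖x‖ ≠ 0 := norm_ne_zero_iff.2 hx
  have h1 := isMinOn_iff.1 hmin (((‖x‖⁻¹ : ℝ) : ℂ) • x) (by simp [norm_smul, hx'])
  rw [map_smul, inner_smul_left, inner_smul_right, Complex.conj_ofReal, Complex.re_ofReal_mul,
    Complex.re_ofReal_mul] at h1
  calc (inner ℂ v (T v)).re * ‖x‖ ^ 2
      ≤ (‖x‖⁻¹ * (‖x‖⁻¹ * (inner ℂ x (T x)).re)) * ‖x‖ ^ 2 := by gcongr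
    _ = _ := by field_simp

theorem numDown_comp_finRotate {L : ℕ} (s : Fin L → Fin 2) :
    numDown (fun k => s (finRotate L k)) = numDown s := by
  rw [numDown_eq_sum, numDown_eq_sum]
  exact Equiv.sum_comp (finRotate L) fun k => (s k : ℕ)

theorem translation_apply {L : ℕ} (ψ : Chain L) (s : Fin L → Fin 2) :
    translation L ψ s = ψ fun k => s (finRotate L k) := rfl

theorem translation_gaugedAbs (ζ : ℝ) {L : ℕ} (ψ : Chain L) :
    translation L (gaugedAbs ζ ψ) = gaugedAbs ζ (translation L ψ) := by
  ext s
  rw [translation_apply, gaugedAbs_apply, gaugedAbs_apply, translation_apply, gaugeSign,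
    gaugeSign, numDown_comp_finRotate]

theorem translation_pow_gaugedAbs (ζ : ℝ) {L : ℕ} (k : ℕ) (ψ : Chain L) :
    (translation L ^ k) (gaugedAbs ζ ψ) = gaugedAbs ζ ((translation L ^ k) ψ) := by
  induction k with
  | zero => rfl
  | succ k ih =>
    rw [pow_succ', Module.End.mul_apply, ih, translation_gaugedAbs, Module.End.mul_apply]

theorem re_inner_gaugedAbs_nonneg (ζ : ℝ) {L : ℕ} (φ ψ : Chain L) :
    0 ≤ (inner ℂ (gaugedAbs ζ φ) (gaugedAbs ζ ψ)).re := by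
  rw [PiLp.inner_apply, Complex.re_sum]
  refine Finset.sum_nonneg fun s _ => ?_
  rw [RCLike.inner_apply, gaugedAbs_apply, gaugedAbs_apply, Complex.conj_ofReal,
    ← Complex.ofReal_mul, Complex.ofReal_re]
  have h : gaugeSign ζ s * ‖ψ s‖ * (gaugeSign ζ s * ‖φ s‖) = ‖ψ s‖ * ‖φ s‖ := by
    linear_combination ‖ψ s‖ * ‖φ s‖ * gaugeSign_mul_self ζ s
  rw [h]
  positivity

theorem re_inner_self {E : Type*} [NormedAddCommGroup E] [InnerProductSpace ℂ E] (x : E) :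
    (inner ℂ x x).re = ‖x‖ ^ 2 := by
  rw [inner_self_eq_norm_sq_to_K]
  norm_cast

/-- The gauge is translation invariant, so the gauged moduli have non-negative overlap with all
their translates. For odd length these enter with sign +1, and the untranslated term is ‖ψ‖² > 0. -/
theorem altSum_gaugedAbs_ne_zero (ζ : ℝ) {L : ℕ} (hL : Odd L) {ψ : Chain L} (hψ : ψ ≠ 0) :
    altSum L (gaugedAbs ζ ψ) ≠ 0 := by
  intro h
  have h1 : (inner ℂ (gaugedAbs ζ ψ) (altSum L (gaugedAbs ζ ψ))).re = 0 := by simp [h]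
  rw [altSum_apply, inner_sum, Complex.re_sum, Finset.sum_eq_zero_iff_of_nonneg] at h1
  · have h2 := h1 0 (Finset.mem_range.2 hL.pos)
    rw [pow_zero, one_smul, pow_zero, Module.End.one_apply, re_inner_self, norm_gaugedAbs] at h2
    exact hψ (by simpa using h2)
  · intro k _
    rw [altSign_of_odd hL, one_pow, one_smul, translation_pow_gaugedAbs]
    exact re_inner_gaugedAbs_nonneg ζ _ _

theorem altSum_shiftedXYZ (ζ : ℝ) {L : ℕ} (ψ : Chain L) :
    altSum L (shiftedXYZ L ζ ψ) = shiftedXYZ L ζ (altSum L ψ) := by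
  have h : ∀ k : ℕ, (translation L ^ k) (shiftedXYZ L ζ ψ) =
      shiftedXYZ L ζ ((translation L ^ k) ψ) := fun k => by
    induction k with
    | zero => rfl
    | succ k ih =>
      rw [pow_succ', Module.End.mul_apply, ih, translation_shiftedXYZ, Module.End.mul_apply]
  simp only [altSum_apply, map_sum, map_smul, h]

/-- The lowest eigenvalue μ over the whole space is attained at an alternate-cyclic vector w, namely
the symmetrized gauged moduli of a minimizer. There μ‖w‖² is a sum of two squared norms, hence μ ≥
0. -/
theorem re_inner_shiftedXYZ_nonneg (ζ : ℝ) {L : ℕ} (hodd : Odd (L + 2)) (x : Chain (L + 2)) :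
    0 ≤ (inner ℂ x (shiftedXYZ _ ζ x)).re := by
  obtain ⟨μ, v, hv, hμ, hvμ⟩ := exists_minimizer (shiftedXYZ (L + 2) ζ)
  have h1 : shiftedXYZ (L + 2) ζ (gaugedAbs ζ v) = (μ : ℂ) • gaugedAbs ζ v := by
    refine apply_eq_of_re_inner_eq (isSymmetric_shiftedXYZ ζ (by omega)) hμ ?_
    rw [norm_gaugedAbs, ← hvμ]
    exact re_inner_shiftedXYZ_gaugedAbs_le ζ (by omega) v
  set w := altSum (L + 2) (gaugedAbs ζ v) with hw
  have hw0 : w ≠ 0 := altSum_gaugedAbs_ne_zero ζ hodd hv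
  have h2 : shiftedXYZ (L + 2) ζ w = (μ : ℂ) • w := by
    rw [hw, ← altSum_shiftedXYZ, h1, map_smul]
  have h3 : 0 ≤ μ * ‖w‖ ^ 2 := by
    rw [← re_inner_self, ← Complex.re_ofReal_mul, ← inner_smul_right, ← h2,
      inner_shiftedXYZ_eq_supercharge ζ hodd (altSum_mem _), Complex.add_re, re_inner_self,
      re_inner_self]
    positivity
  have h4 : 0 ≤ μ := nonneg_of_mul_nonneg_left h3 (by positivity)
  exact le_trans (by positivity) (hμ x)

theorem shiftedXYZ_eq_zero (ζ : ℝ) {L : ℕ} (hodd : Odd (L + 2)) {x : Chain (L + 2)}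
    (hx : (inner ℂ x (shiftedXYZ _ ζ x)).re ≤ 0) : shiftedXYZ _ ζ x = 0 := by
  have := apply_eq_of_re_inner_eq (isSymmetric_shiftedXYZ ζ (by omega)) (μ := 0)
    (fun x => by simpa using re_inner_shiftedXYZ_nonneg ζ hodd x) (v := x) (by simpa using hx)
  simpa using this

/-! ### Propagation of zeros and the dimension of the kernel -/

/-- The gauged moduli of ψ also lie in the kernel. At a configuration s with ψ s = 0 the kernel
equation has no diagonal part, and its off-diagonal terms all carry the same sign, so each vanishes.
Since ζ ≠ 0, no amplitude is zero and the neighbouring coordinate must be. -/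
theorem apply_flipPair_eq_zero {ζ : ℝ} (hζ : ζ ≠ 0) {L : ℕ} (hodd : Odd (L + 2))
    {ψ : Chain (L + 2)} (hψ : shiftedXYZ _ ζ ψ = 0) {s : Fin (L + 2) → Fin 2} (hs : ψ s = 0)
    (j : Fin (L + 2)) : ψ (flipPair j (finRotate _ j) s) = 0 := by
  have hne := ne_finRotate (L := L + 2) (by omega)
  have h1 : shiftedXYZ _ ζ (gaugedAbs ζ ψ) = 0 := by
    refine shiftedXYZ_eq_zero ζ hodd ((re_inner_shiftedXYZ_gaugedAbs_le ζ (by omega) ψ).trans ?_)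
    simp [hψ]
  have h2 : ∑ j : Fin (L + 2), |bondOff ζ (s j) (s (finRotate _ j))| *
      ‖ψ (flipPair j (finRotate _ j) s)‖ = 0 := by
    have h3 : shiftedXYZ _ ζ (gaugedAbs ζ ψ) s = 0 := by
      rw [h1]
      rfl
    have h4 : ∀ j : Fin (L + 2), bondOp ζ j (finRotate _ j) (gaugedAbs ζ ψ) s =
        -gaugeSign ζ s * ((|bondOff ζ (s j) (s (finRotate _ j))| *
          ‖ψ (flipPair j (finRotate _ j) s)‖ : ℝ) : ℂ) := fun j => by
      rw [bondOp_apply ζ (hne j), gaugedAbs_apply, gaugedAbs_apply, hs, norm_zero, mul_zero,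
        Complex.ofReal_zero, mul_zero, zero_sub, ← Complex.ofReal_mul, ← mul_assoc,
        bondOff_mul_gaugeSign ζ (hne j)]
      push_cast
      ring
    have h5 : (gaugeSign ζ s : ℂ) ≠ 0 := fun h => by
      have := gaugeSign_mul_self ζ s
      rw [Complex.ofReal_eq_zero.1 h] at this
      norm_num at this
    simp only [shiftedXYZ, LinearMap.sum_apply, WithLp.ofLp_sum, Finset.sum_apply, h4,
      ← Finset.mul_sum, ← Complex.ofReal_sum] at h3
    exact Complex.ofReal_eq_zero.1 ((mul_eq_zero.1 h3).resolve_left (neg_ne_zero.2 h5))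
  rw [Finset.sum_eq_zero_iff_of_nonneg fun j _ => by positivity] at h2
  have h6 : bondOff ζ (s j) (s (finRotate _ j)) ≠ 0 := by
    rw [bondOff]
    split_ifs <;> simp [hζ]
  have h7 := h2 j (Finset.mem_univ j)
  rw [mul_eq_zero, abs_eq_zero, norm_eq_zero] at h7
  exact h7.resolve_left h6

theorem eq_zero_of_shiftedXYZ_eq_zero {ζ : ℝ} (hζ : ζ ≠ 0) {L : ℕ} (hodd : Odd (L + 2))
    {ψ : Chain (L + 2)} (hψ : shiftedXYZ _ ζ ψ = 0)
    (h0 : ∀ a, ψ (Function.update 0 (Fin.last (L + 1)) a) = 0) : ψ = 0 := by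
  -- Spins down are swept to the right: k is the length of an initial block of spins up. When k
  -- reaches L + 1, only the last spin is free and the two assumed zeros apply.
  have key : ∀ d k : ℕ, k + d = L + 1 → ∀ s : Fin (L + 2) → Fin 2,
      (∀ i : Fin (L + 2), (i : ℕ) < k → s i = 0) → ψ s = 0 := by
    intro d
    induction d with
    | zero =>
      intro k hk s hs
      rw [← h0 (s (Fin.last (L + 1)))]
      refine congrArg ψ.ofLp (funext fun i => ?_)
      by_cases hi : i = Fin.last (L + 1)
      · subst hi
        simp
      · rw [Function.update_of_ne hi, hs i]
        · rfl
        · have := i.2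
          have : (i : ℕ) ≠ L + 1 := fun h => hi (Fin.ext h)
          omega
    | succ d ih =>
      intro k hk s hs
      set j : Fin (L + 2) := ⟨k, by omega⟩ with hj
      by_cases hsj : s j = 0
      · refine ih (k + 1) (by omega) s fun i hi => ?_
        rcases Nat.lt_succ_iff_lt_or_eq.1 hi with hi | hi
        · exact hs i hi
        · rwa [show i = j from Fin.ext hi]
      · have hne := ne_finRotate (L := L + 2) (by omega) j
        have hs1 : s j = 1 := by
          generalize s j = a at hsj
          fin_cases a
          · exact absurd rfl hsj
          · rfl
        have hv : (finRotate (L + 2) j : ℕ) = k + 1 := by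
          rw [finRotate_apply, Fin.val_add_one_of_lt (by rw [Fin.lt_def]; simp [hj]; omega)]
        -- Reversing sites k and k + 1 removes the spin down at k. The coordinate then vanishes by
        -- induction, and reversing the same pair again carries the zero back to s. No bond across
        -- the boundary is used.
        rw [← flipPair_involutive hne s]
        refine apply_flipPair_eq_zero hζ hodd hψ (ih (k + 1) (by omega) _ fun i hi => ?_) j
        by_cases hij : i = j
        · rw [hij, flipPair_apply_left hne, hs1]
          rfl
        · have h1 : (i : ℕ) ≠ k := fun h => hij (Fin.ext h)
          rw [flipPair_apply_of_ne hij (fun h => by rw [h] at hi; omega), hs i (by omega)]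
  ext s
  exact key (L + 1) 0 (by omega) s fun i hi => absurd hi (Nat.not_lt_zero _)

theorem finrank_ker_shiftedXYZ_le {ζ : ℝ} (hζ : ζ ≠ 0) {L : ℕ} (hodd : Odd (L + 2)) :
    Module.finrank ℂ (LinearMap.ker (shiftedXYZ (L + 2) ζ)) ≤ 2 := by
  let f : LinearMap.ker (shiftedXYZ (L + 2) ζ) →ₗ[ℂ] (Fin 2 → ℂ) :=
    { toFun := fun ψ a => ψ.1 (Function.update 0 (Fin.last (L + 1)) a)
      map_add' := fun _ _ => rfl
      map_smul' := fun _ _ => rfl }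
  have hf : Function.Injective f := by
    rw [injective_iff_map_eq_zero]
    exact fun ψ h => Subtype.ext (eq_zero_of_shiftedXYZ_eq_zero hζ hodd ψ.2 (congrFun h))
  simpa using LinearMap.finrank_le_finrank_of_injective hf

/-! ### Nilpotency of the supercharge -/

theorem word_split_eq (ζ : ℝ) {L : ℕ} (ψ : Chain L) (l : List (Fin 2)) (h : l.length = L + 1) :
    word (L + 1) (split ζ ψ) l = splitWord ζ (word L ψ) l := word_ofWord _ _ h

theorem split_sum (ζ : ℝ) {L : ℕ} {ι : Type*} (t : Finset ι) (x : ι → Chain L) :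
    split ζ (∑ k ∈ t, x k) = ∑ k ∈ t, split ζ (x k) := by
  refine word_ext fun l hl => ?_
  rw [map_sum, Finset.sum_apply]
  simp only [word_split_eq ζ _ l hl]
  rcases l with _ | ⟨a, _ | ⟨b, X⟩⟩ <;> simp [splitWord, Finset.mul_sum]

/-- The iterated local supercharge, with a translation in between. -/
def doubleSplit (ζ : ℝ) {L : ℕ} (k : ℕ) (ψ : Chain L) : Chain (L + 2) :=
  split ζ ((translation (L + 1) ^ k) (split ζ ψ))

theorem word_doubleSplit (ζ : ℝ) {L k : ℕ} (ψ : Chain L) {a b c d : Fin 2}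
    {Y Z : List (Fin 2)} (hZ : (1 :: Z).rotate k = c :: d :: Y) (hL : Z.length = L) :
    word (L + 2) (doubleSplit ζ k ψ) (a :: b :: Z) =
      pairWeight ζ a b * (pairWeight ζ c d * word L ψ (1 :: Y)) := by
  have hY : Y.length + 1 = L := by
    have := congrArg List.length hZ
    simp at this
    omega
  rw [doubleSplit, word_split _ _ _ _ _ (by omega), word_translation_pow, hZ,
    word_split _ _ _ _ _ hY]

/-- Splitting two different sites gives the same state in either order up to a translation. The
translation by p + 2 on the longer chain and the reordering by p + 1 on the shorter one, both with
sector sign -1, combine to an overall minus. -/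
theorem altSum_doubleSplit_succ (ζ : ℝ) {p q : ℕ} (heven : Even (p + q + 2))
    {ψ : Chain (p + q + 2)} (h : ψ ∈ altCyclic (p + q + 2)) :
    altSum _ (doubleSplit ζ (p + 1) ψ) = -altSum _ (doubleSplit ζ (q + 1) ψ) := by
  have hT : doubleSplit ζ (p + 1) ψ =
      (-1 : ℂ) ^ (p + 1) • (translation _ ^ (p + 2)) (doubleSplit ζ (q + 1) ψ) := by
    refine word_ext fun l hl => ?_
    obtain ⟨a, l, rfl⟩ := List.exists_cons_of_length_pos (by omega : 0 < l.length)
    obtain ⟨b, l, rfl⟩ := List.exists_cons_of_length_pos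
      (by simp at hl; omega : 0 < l.length)
    obtain ⟨X, c, d, Y, rfl, hX, hY⟩ := exists_eq_append_cons_cons (l := l) (k := p)
      (by simp at hl; omega)
    have hYq : Y.length = q := by
      simp at hl hY
      omega
    have r1 : (1 :: (X ++ c :: d :: Y)).rotate (p + 1) = c :: d :: (Y ++ 1 :: X) := by
      rw [rotate_append_cons (by omega)]
      rfl
    have r2 : (1 :: (Y ++ a :: b :: X)).rotate (q + 1) = a :: b :: (X ++ 1 :: Y) := by
      rw [rotate_append_cons (by omega)]
      rfl
    have r3 : (a :: b :: (X ++ c :: d :: Y)).rotate (p + 2) = c :: d :: (Y ++ a :: b :: X) := by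
      rw [rotate_append_cons_cons (by omega)]
      rfl
    have hψ := word_append_comm h (1 :: X) (1 :: Y)
    rw [altSign_of_even heven, List.length_cons, hX, List.cons_append, List.cons_append] at hψ
    rw [map_smul, Pi.smul_apply, word_translation_pow, r3,
      word_doubleSplit ζ ψ r1 (by simp; omega),
      word_doubleSplit ζ ψ r2 (by simp; omega), hψ, smul_eq_mul]
    ring
  rw [hT, map_smul, altSum_translation_pow, altSign_of_even (by grind), smul_smul, ← pow_add,
    Odd.neg_one_pow (by grind), neg_one_smul]

theorem altSum_add_translation {N : ℕ} (heven : Even N) (D : Chain N) :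
    altSum N (D + translation N D) = 0 := by
  rw [map_add, altSum_translation, altSign_of_even heven, neg_one_smul, add_neg_cancel]

/-- Splitting one of the two letters just created is governed by the local identity (𝔮⊗1 - 1⊗𝔮)𝔮|s⟩
= χ⊗|s⟩ - |s⟩⊗χ with χ = -ζ|↑↑⟩. The right-hand side becomes a boundary term of the form D plus its
translate, which the even-length projection kills. -/
theorem altSum_doubleSplit_zero_add (ζ : ℝ) {K : ℕ} (heven : Even (K + 2))
    {ψ : Chain (K + 2)} (h : ψ ∈ altCyclic (K + 2)) :
    altSum _ (doubleSplit ζ 0 ψ) + altSum _ (doubleSplit ζ (K + 2) ψ) = 0 := by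
  have he : Even (K + 2 + 2) := by grind
  let D : Chain (K + 2 + 2) := ofWord _ fun l => match l with
    | a :: b :: Y => if a = 0 ∧ b = 0 then word _ ψ Y else 0
    | _ => 0
  have hD : doubleSplit ζ 0 ψ - translation _ (doubleSplit ζ (K + 2) ψ) =
      (-ζ : ℂ) • (D + translation _ D) := by
    refine word_ext fun l hl => ?_
    obtain ⟨a, l, rfl⟩ := List.exists_cons_of_length_pos (by omega : 0 < l.length)
    obtain ⟨b, l, rfl⟩ := List.exists_cons_of_length_pos
      (by simp at hl; omega : 0 < l.length)
    obtain ⟨c, Y, rfl⟩ := List.exists_cons_of_length_pos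
      (by simp at hl; omega : 0 < l.length)
    have hY : Y.length = K + 1 := by simpa using hl
    have r1 : (a :: b :: c :: Y).rotate 1 = b :: c :: (Y ++ [a]) := by simp
    have r2 : (1 :: (Y ++ [a])).rotate (K + 2) = a :: 1 :: Y := by
      rw [rotate_append_cons (by omega)]
      rfl
    have hD1 : ∀ (a b : Fin 2) (Y : List (Fin 2)) (hY : Y.length = K + 2),
        word _ D (a :: b :: Y) = if a = 0 ∧ b = 0 then word _ ψ Y else 0 := fun a b Y hY =>
      word_ofWord _ _ (by simp [hY])
    have hψ := word_append_comm h [a] Y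
    rw [altSign_of_even heven] at hψ
    simp only [map_sub, map_smul, map_add, Pi.sub_apply, Pi.smul_apply, Pi.add_apply,
      word_translation, r1, smul_eq_mul]
    rw [word_doubleSplit ζ ψ (List.rotate_zero _) (by simp [hY]),
      word_doubleSplit ζ ψ r2 (by simp [hY]), hD1 _ _ _ (by simp [hY]),
      hD1 _ _ _ (by simp [hY]), hψ]
    have h2 : ∀ a : Fin 2, a = 0 ∨ a = 1 := by decide
    rcases h2 a with rfl | rfl <;> rcases h2 b with rfl | rfl <;> rcases h2 c with rfl | rfl <;>
      simp
  have h1 := congrArg (altSum _) hD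
  rw [map_smul, altSum_add_translation he, smul_zero, map_sub, altSum_translation,
    altSign_of_even he, neg_one_smul, sub_neg_eq_add] at h1
  exact h1

theorem altSum_split_altSum_split (ζ : ℝ) {K : ℕ} (heven : Even (K + 2))
    {ψ : Chain (K + 2)} (h : ψ ∈ altCyclic (K + 2)) :
    altSum _ (split ζ (altSum _ (split ζ ψ))) = 0 := by
  have h0 : split ζ (altSum _ (split ζ ψ)) =
      ∑ k ∈ Finset.range (K + 2 + 1), doubleSplit ζ k ψ := by
    rw [altSum_apply, split_sum]
    refine Finset.sum_congr rfl fun k _ => ?_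
    rw [altSign_of_odd (by grind), one_pow, one_smul, doubleSplit]
  -- Reflecting the index exchanges the two orders of splitting, so this sum equals its own
  -- negative.
  have h1 : ∑ k ∈ Finset.range (K + 1), altSum _ (doubleSplit ζ (k + 1) ψ) = 0 := by
    have h2 := Finset.sum_range_reflect (fun k => altSum _ (doubleSplit ζ (k + 1) ψ)) (K + 1)
    rw [Finset.sum_congr rfl fun k hk => (?_ : _ = -altSum _ (doubleSplit ζ (k + 1) ψ)),
      Finset.sum_neg_distrib] at h2
    · have h3 := add_eq_zero_iff_eq_neg.2 h2.symm
      rw [← two_smul ℂ] at h3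
      exact (smul_eq_zero.1 h3).resolve_left two_ne_zero
    · obtain ⟨q, rfl⟩ := Nat.exists_eq_add_of_le (Nat.le_of_lt_succ (Finset.mem_range.1 hk))
      rw [altSum_doubleSplit_succ ζ heven h, neg_neg]
      congr 3
      omega
  rw [h0, map_sum, Finset.sum_range_succ, Finset.sum_range_succ', h1, zero_add]
  exact altSum_doubleSplit_zero_add ζ heven h

theorem split_smul (ζ : ℝ) {L : ℕ} (c : ℂ) (x : Chain L) :
    split ζ (c • x) = c • split ζ x := by
  refine word_ext fun l hl => ?_
  rw [map_smul, Pi.smul_apply, word_split_eq ζ _ l hl, word_split_eq ζ _ l hl, map_smul]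
  rcases l with _ | ⟨a, _ | ⟨b, X⟩⟩ <;> simp [splitWord]
  ring

theorem supercharge_supercharge (ζ : ℝ) {M : ℕ} (heven : Even M) (hM : 0 < M) (α : Chain M) :
    supercharge ζ (M + 1) (supercharge ζ M α) = 0 := by
  obtain ⟨K, rfl⟩ : ∃ K, M = K + 2 := ⟨M - 2, by grind⟩
  rw [supercharge_apply ζ (by omega), starProjection_of_mem (supercharge_mem ζ hM α),
    supercharge_apply ζ hM, split_smul, map_smul,
    altSum_split_altSum_split ζ heven (Submodule.starProjection_apply_mem _ α), smul_zero, smul_zero]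

/-! ### Explicit cocycles and their duals -/

theorem numDown_eq_count {L : ℕ} (s : Fin L → Fin 2) : numDown s = (List.ofFn s).count 1 := by
  rw [numDown_eq_sum]
  induction L with
  | zero => simp
  | succ m ih =>
    rw [Fin.sum_univ_succ, ih, List.ofFn_succ, List.count_cons, add_comm]
    congr 1
    generalize s 0 = a
    fin_cases a <;> rfl

/-- The state whose coordinates are `F d` on the configurations with `d` spins down. -/
def countState (L : ℕ) (F : ℕ → ℂ) : Chain L := WithLp.toLp 2 fun s => F (numDown s)

theorem word_countState {L : ℕ} (F : ℕ → ℂ) (l : List (Fin 2)) (h : l.length = L) :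
    word L (countState L F) l = F (l.count 1) := by
  rw [← ofFn_get_cast l h, word_ofFn, ← numDown_eq_count]
  rfl

theorem countState_mem {L : ℕ} (hL : Odd L) (F : ℕ → ℂ) : countState L F ∈ altCyclic L := by
  rw [mem_altCyclic, altSign_of_odd hL, one_smul]
  ext s
  rw [translation_apply]
  exact congrArg F (numDown_comp_finRotate s)

/-- The split state is D plus its translate, where D has coordinates F(d + 1)/2 times the sign of
the first spin. Antiparallel first letters cancel; parallel ones add up to F(d + 1) times that sign,
and the recursion turns F(d + 2) into ζF(d) for two spins down. -/
theorem altSum_split_countState (ζ : ℝ) {L : ℕ} (hL : Odd L) {F : ℕ → ℂ}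
    (hF : ∀ d, F (d + 2) = ζ * F d) : altSum (L + 1) (split ζ (countState L F)) = 0 := by
  let D : Chain (L + 1) := ofWord _ fun l => match l with
    | a :: X => F ((a :: X).count 1 + 1) * (if a = 1 then -(1 / 2) else 1 / 2)
    | [] => 0
  have hD1 : ∀ (a : Fin 2) (X : List (Fin 2)) (hX : X.length = L), word _ D (a :: X) =
      F ((a :: X).count 1 + 1) * (if a = 1 then -(1 / 2) else 1 / 2) := fun a X hX =>
    word_ofWord _ _ (by simp [hX])
  have hD : split ζ (countState L F) = D + translation _ D := by
    refine word_ext fun l hl => ?_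
    have hpos := hL.pos
    obtain ⟨a, l, rfl⟩ := List.exists_cons_of_length_pos (by omega : 0 < l.length)
    obtain ⟨b, X, rfl⟩ := List.exists_cons_of_length_pos
      (by simp at hl; omega : 0 < l.length)
    have hX : X.length + 1 = L := by simpa using hl
    have r1 : (a :: b :: X).rotate 1 = b :: (X ++ [a]) := by simp
    rw [map_add, Pi.add_apply, word_translation, r1, word_split _ _ _ _ _ hX,
      word_countState _ _ (by simp [hX]), hD1 _ _ (by simp [hX]), hD1 _ _ (by simp [hX])]
    have h2 : ∀ a : Fin 2, a = 0 ∨ a = 1 := by decide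
    rcases h2 a with rfl | rfl <;> rcases h2 b with rfl | rfl <;>
      simp [List.count_append, hF]
    all_goals ring
  rw [hD, altSum_add_translation hL.add_one]

theorem supercharge_countState (ζ : ℝ) {L : ℕ} (hL : Odd L) {F : ℕ → ℂ}
    (hF : ∀ d, F (d + 2) = ζ * F d) : supercharge ζ L (countState L F) = 0 := by
  rw [supercharge_apply ζ hL.pos, starProjection_of_mem (countState_mem hL F),
    altSum_split_countState ζ hL hF, smul_zero]

/-- The reversed recursion says that the coordinate at ↑↑X equals ζ times the one at ↓↓X, so the
adjoint of the local supercharge annihilates the state. -/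
theorem inner_countState_supercharge (ζ : ℝ) {M : ℕ} (heven : Even M) (hM : 0 < M) {F : ℕ → ℂ}
    (hF : ∀ d, d + 2 ≤ M + 1 → F d = ζ * F (d + 2)) (α : Chain M) :
    inner ℂ (countState (M + 1) F) (supercharge ζ M α) = 0 := by
  obtain ⟨L, rfl⟩ : ∃ L, M = L + 1 := ⟨M - 1, by omega⟩
  rw [inner_supercharge ζ hM (countState_mem heven.add_one F), inner_split,
    wordSum_congr (g := fun _ => 0) fun X hX => ?_]
  · simp
  · have hc : X.count 1 ≤ X.length := List.count_le_length
    have hw := fun a b : Fin 2 =>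
      word_countState (L := L + 2) F (a :: b :: X) (by simp [hX])
    have h0 : word (L + 2) (countState (L + 2) F) (0 :: 0 :: X) -
        ζ * word (L + 2) (countState (L + 2) F) (1 :: 1 :: X) = 0 := by
      rw [hw, hw]
      simp [hF (X.count 1) (by omega)]
    exact mul_eq_zero_of_left ((congrArg conj h0).trans (map_zero _)) _

/-- The cocycle of spin parity `r`: its coordinates are powers of `ζ`. -/
def cocycle (ζ : ℝ) (M r : ℕ) : Chain (M + 1) :=
  countState (M + 1) fun d => if d % 2 = r then (ζ : ℂ) ^ (d / 2) else 0

/-- A state orthogonal to the range of the supercharge, dual to `cocycle`. -/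
def dualCocycle (ζ : ℝ) (M r : ℕ) : Chain (M + 1) :=
  countState (M + 1) fun d => if d % 2 = r then (ζ : ℂ) ^ ((M + 1 - d) / 2) else 0

theorem supercharge_cocycle (ζ : ℝ) {M : ℕ} (heven : Even M) (r : ℕ) :
    supercharge ζ (M + 1) (cocycle ζ M r) = 0 := by
  refine supercharge_countState ζ heven.add_one fun d => ?_
  rw [Nat.add_mod_right, Nat.add_div_right _ two_pos, pow_succ]
  split_ifs <;> ring

theorem inner_dualCocycle_supercharge (ζ : ℝ) {M : ℕ} (heven : Even M) (hM : 0 < M) (r : ℕ)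
    (α : Chain M) : inner ℂ (dualCocycle ζ M r) (supercharge ζ M α) = 0 := by
  refine inner_countState_supercharge ζ heven hM (fun d hd => ?_) α
  rw [Nat.add_mod_right, show (M + 1 - d) / 2 = (M + 1 - (d + 2)) / 2 + 1 by omega, pow_succ]
  split_ifs <;> ring

theorem inner_dualCocycle_cocycle_of_ne (ζ : ℝ) (M : ℕ) {r t : ℕ} (h : r ≠ t) :
    inner ℂ (dualCocycle ζ M r) (cocycle ζ M t) = 0 := by
  rw [PiLp.inner_apply]
  refine Finset.sum_eq_zero fun s _ => ?_
  simp only [RCLike.inner_apply, cocycle, dualCocycle, countState]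
  split_ifs with h1 h2
  · exact absurd (h2.symm.trans h1) h
  all_goals simp

theorem numDown_le {L : ℕ} (s : Fin L → Fin 2) : numDown s ≤ L := by
  simpa [numDown] using Finset.card_filter_le (Finset.univ : Finset (Fin L)) fun j => s j = 1

/-- As M + 1 is odd, exactly one of d and M + 1 - d is odd, so the rounded halves add up to M / 2
for every d. All non-zero terms equal ζ^(M/2), and no cancellation can occur even for ζ < 0. -/
theorem inner_dualCocycle_cocycle_ne_zero {ζ : ℝ} (hζ : ζ ≠ 0) {M : ℕ} (heven : Even M) {r : ℕ}
    (hr : r < 2) : inner ℂ (dualCocycle ζ M r) (cocycle ζ M r) ≠ 0 := by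
  have h1 : inner ℂ (dualCocycle ζ M r) (cocycle ζ M r) =
      ∑ s : Fin (M + 1) → Fin 2, if numDown s % 2 = r then (ζ : ℂ) ^ (M / 2) else 0 := by
    rw [PiLp.inner_apply]
    refine Finset.sum_congr rfl fun s _ => ?_
    have hs := numDown_le s
    simp only [RCLike.inner_apply, cocycle, dualCocycle, countState]
    split_ifs with h
    · rw [map_pow, Complex.conj_ofReal, ← pow_add]
      congr 1
      grind
    · simp
  have h2 : numDown (Function.update 0 (0 : Fin (M + 1)) ⟨r, hr⟩) = r := by
    have := numDown_update (0 : Fin (M + 1) → Fin 2) 0 ⟨r, hr⟩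
    have h0 : numDown (0 : Fin (M + 1) → Fin 2) = 0 := by simp [numDown]
    simpa [h0] using this
  rw [h1, ← Finset.sum_filter, Finset.sum_const, nsmul_eq_mul]
  refine mul_ne_zero ?_ (pow_ne_zero _ (by exact_mod_cast hζ))
  rw [Nat.cast_ne_zero, Finset.card_ne_zero]
  exact ⟨Function.update 0 0 ⟨r, hr⟩, by simp [h2, Nat.mod_eq_of_lt hr]⟩

theorem phi_eq_cocycle (n : ℕ) (ζ : ℝ) : phi n ζ = cocycle ζ (2 * n) 1 := by
  ext s
  simp [phi, phiOne_apply, cocycle, countState, Nat.odd_iff]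

theorem phiBar_eq_cocycle (n : ℕ) (ζ : ℝ) : phiBar n ζ = cocycle ζ (2 * n) 0 := by
  ext s
  simp [phiBar, phiBarOne_apply, cocycle, countState, Nat.even_iff]

/-! ### Zero-energy states as harmonic representatives -/

theorem susyHamiltonian_apply_eq_zero_iff (ζ : ℝ) (L : ℕ) (Ψ : Chain (L + 1)) :
    susyHamiltonian ζ L Ψ = 0 ↔
      supercharge ζ (L + 1) Ψ = 0 ∧ LinearMap.adjoint (supercharge ζ L) Ψ = 0 := by
  simp only [susyHamiltonian, LinearMap.add_apply, LinearMap.comp_apply]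
  refine ⟨fun h => ?_, fun h => by rw [h.1, h.2, map_zero, map_zero, add_zero]⟩
  have h1 : (inner ℂ Ψ (0 : Chain (L + 1))).re = 0 := by simp
  rw [← h, inner_add_right, LinearMap.adjoint_inner_right, ← LinearMap.adjoint_inner_left,
    Complex.add_re, re_inner_self, re_inner_self] at h1
  have h2 := (add_eq_zero_iff_of_nonneg (by positivity) (by positivity)).1 h1
  exact ⟨by simpa using h2.2, by simpa using h2.1⟩

theorem shiftedXYZ_of_zeroEnergy {ζ : ℝ} {M : ℕ} (heven : Even M) (hM : 0 < M)
    {Ψ : Chain (M + 1)} (h : IsAltCyclicZeroEnergy ζ M Ψ) : shiftedXYZ (M + 1) ζ Ψ = 0 := by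
  obtain ⟨L, rfl⟩ : ∃ L, M = L + 1 := ⟨M - 1, by omega⟩
  obtain ⟨h1, h2⟩ := (susyHamiltonian_apply_eq_zero_iff ζ _ Ψ).1 h.2.2
  refine shiftedXYZ_eq_zero ζ heven.add_one (le_of_eq ?_)
  rw [inner_shiftedXYZ_eq_supercharge ζ heven.add_one h.2.1, h1, h2]
  simp

/-- The harmonic representative is the cocycle minus its orthogonal projection onto the range of Q:
orthogonality gives Q†Ψ = 0, and Q² = 0 keeps QΨ = 0. It is non-zero because the dual cocycle,
orthogonal to that range, detects the cocycle. -/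
theorem exists_zeroEnergy {ζ : ℝ} (hζ : ζ ≠ 0) {M : ℕ} (heven : Even M) (hM : 0 < M) {r : ℕ}
    (hr : r < 2) : ∃ Ψ, IsAltCyclicZeroEnergy ζ M Ψ ∧ ∃ c : ℂ, ∃ α ∈ altCyclic M,
      Ψ = c • cocycle ζ M r + supercharge ζ M α := by
  set R := LinearMap.range (supercharge ζ M) with hR
  obtain ⟨β, hβ⟩ : R.starProjection (cocycle ζ M r) ∈ R := Submodule.starProjection_apply_mem _ _
  have hform : cocycle ζ M r - supercharge ζ M β = (1 : ℂ) • cocycle ζ M r +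
      supercharge ζ M ((altCyclic M).starProjection (-β)) := by
    rw [supercharge_starProjection, map_neg, one_smul, sub_eq_add_neg]
  refine ⟨cocycle ζ M r - supercharge ζ M β, ⟨fun h => ?_, ?_, ?_⟩, 1, _,
    Submodule.starProjection_apply_mem _ _, hform⟩
  · refine inner_dualCocycle_cocycle_ne_zero hζ heven hr ?_
    rw [sub_eq_zero.1 h, inner_dualCocycle_supercharge ζ heven hM]
  · exact Submodule.sub_mem _ (countState_mem heven.add_one _) (supercharge_mem ζ hM β)
  · rw [susyHamiltonian_apply_eq_zero_iff, map_sub, supercharge_cocycle ζ heven,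
      supercharge_supercharge ζ heven hM, sub_zero]
    refine ⟨rfl, ext_inner_right ℂ fun φ => ?_⟩
    rw [LinearMap.adjoint_inner_left, inner_zero_left, hβ]
    exact Submodule.starProjection_inner_eq_zero _ _ ⟨φ, rfl⟩

/-- A zero-energy state is orthogonal to the range of Q; if it also lay in that range, it would be
orthogonal to itself. -/
theorem coeff_ne_zero {ζ : ℝ} {M r : ℕ} {Ψ : Chain (M + 1)} (h : IsAltCyclicZeroEnergy ζ M Ψ)
    {c : ℂ} {α : Chain M} (hc : Ψ = c • cocycle ζ M r + supercharge ζ M α) : c ≠ 0 := by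
  rintro rfl
  refine h.1 (inner_self_eq_zero (𝕜 := ℂ).1 ?_)
  rw [zero_smul, zero_add] at hc
  nth_rw 2 [hc]
  rw [← LinearMap.adjoint_inner_left, ((susyHamiltonian_apply_eq_zero_iff ζ M Ψ).1 h.2.2).2,
    inner_zero_left]

theorem linearIndependent_zeroEnergy {ζ : ℝ} (hζ : ζ ≠ 0) {M : ℕ} (heven : Even M) (hM : 0 < M)
    {r t : ℕ} (hr : r < 2) (ht : t < 2) (hrt : r ≠ t) {Ψ Ψ' : Chain (M + 1)}
    (h : IsAltCyclicZeroEnergy ζ M Ψ) (h' : IsAltCyclicZeroEnergy ζ M Ψ') {c c' : ℂ}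
    {α α' : Chain M} (hc : Ψ = c • cocycle ζ M r + supercharge ζ M α)
    (hc' : Ψ' = c' • cocycle ζ M t + supercharge ζ M α') :
    LinearIndependent ℂ ![Ψ, Ψ'] := by
  have hc0 := coeff_ne_zero h hc
  have hc0' := coeff_ne_zero h' hc'
  rw [LinearIndependent.pair_iff]
  intro x y hxy
  have key : ∀ u, x * (c * inner ℂ (dualCocycle ζ M u) (cocycle ζ M r)) +
      y * (c' * inner ℂ (dualCocycle ζ M u) (cocycle ζ M t)) = 0 := fun u => by
    have h1 := congrArg (inner ℂ (dualCocycle ζ M u)) hxy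
    rw [hc, hc'] at h1
    simpa only [inner_add_right, inner_smul_right, inner_dualCocycle_supercharge ζ heven hM,
      add_zero, inner_zero_right] using h1
  have h1 := key r
  have h2 := key t
  rw [inner_dualCocycle_cocycle_of_ne ζ M hrt] at h1
  rw [inner_dualCocycle_cocycle_of_ne ζ M hrt.symm] at h2
  simpa [hc0, hc0', inner_dualCocycle_cocycle_ne_zero hζ heven hr,
    inner_dualCocycle_cocycle_ne_zero hζ heven ht] using And.intro h1 h2

theorem span_zeroEnergy {ζ : ℝ} (hζ : ζ ≠ 0) {M : ℕ} (heven : Even M) (hM : 0 < M)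
    {Ψ Ψ' : Chain (M + 1)} (hlin : LinearIndependent ℂ ![Ψ, Ψ'])
    (h : IsAltCyclicZeroEnergy ζ M Ψ) (h' : IsAltCyclicZeroEnergy ζ M Ψ') :
    Submodule.span ℂ {Ψ, Ψ'} = LinearMap.ker (shiftedXYZ (M + 1) ζ) := by
  refine Submodule.eq_of_le_of_finrank_le ?_ ?_
  · rw [Submodule.span_le]
    rintro x (rfl | rfl)
    · exact shiftedXYZ_of_zeroEnergy heven hM h
    · exact shiftedXYZ_of_zeroEnergy heven hM h'
  · have h2 := finrank_span_eq_card hlin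
    rw [Matrix.range_cons_cons_empty] at h2
    rw [h2]
    obtain ⟨L, rfl⟩ : ∃ L, M = L + 1 := ⟨M - 1, by omega⟩
    simpa using finrank_ker_shiftedXYZ_le hζ heven.add_one

/-! ### Return to the unshifted Hamiltonian and the main theorem -/

theorem mem_eigenspace_susyXYZ {L : ℕ} {ζ E : ℝ} {Ψ : Chain L} :
    Ψ ∈ Module.End.eigenspace (susyXYZ L ζ) (E : ℂ) ↔
      shiftedXYZ L ζ Ψ = ((E + (L : ℝ) * (3 + ζ ^ 2) / 4 : ℝ) : ℂ) • Ψ := by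
  rw [Module.End.mem_eigenspace_iff, shiftedXYZ_eq, LinearMap.add_apply, LinearMap.smul_apply,
    Module.End.one_apply, Complex.ofReal_add, add_smul, add_left_inj]

theorem nonneg_of_hasEigenvalue {ζ : ℝ} {M : ℕ} (heven : Even M) (hM : 0 < M) {E : ℝ}
    (h : Module.End.HasEigenvalue (susyXYZ (M + 1) ζ) (E : ℂ)) :
    0 ≤ E + ((M + 1 : ℕ) : ℝ) * (3 + ζ ^ 2) / 4 := by
  obtain ⟨L, rfl⟩ : ∃ L, M = L + 1 := ⟨M - 1, by omega⟩
  obtain ⟨x, hx, hx0⟩ := h.exists_hasEigenvector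
  have h1 := re_inner_shiftedXYZ_nonneg ζ heven.add_one x
  rw [mem_eigenspace_susyXYZ.1 hx, inner_smul_right, Complex.re_ofReal_mul, re_inner_self] at h1
  exact nonneg_of_mul_nonneg_left h1 (by positivity)

end XYZChain

end

theorem mainTheorem3 (n : ℕ) (hn : 1 ≤ n) (ζ : ℝ) (hζ : ζ ≠ 0) :
    XYZChain.IsGroundEnergy (XYZChain.susyXYZ (2 * n + 1) ζ)
      (-((2 * (n : ℝ) + 1) * (3 + ζ ^ 2) / 4)) ∧
    (∃ Ψ, XYZChain.IsPsi n ζ Ψ) ∧ (∃ Ψ', XYZChain.IsPsiBar n ζ Ψ') ∧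
    ∀ Ψ Ψ' : XYZChain.Chain (2 * n + 1),
      XYZChain.IsPsi n ζ Ψ → XYZChain.IsPsiBar n ζ Ψ' →
        Submodule.span ℂ {Ψ, Ψ'} =
          Module.End.eigenspace (XYZChain.susyXYZ (2 * n + 1) ζ)
            ((-((2 * (n : ℝ) + 1) * (3 + ζ ^ 2) / 4) : ℝ) : ℂ) := by
  open XYZChain in
  have heven : Even (2 * n) := even_two_mul n
  have hpos : 0 < 2 * n := by omega
  have hE : Module.End.eigenspace (susyXYZ (2 * n + 1) ζ)
      ((-((2 * (n : ℝ) + 1) * (3 + ζ ^ 2) / 4) : ℝ) : ℂ) =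
      LinearMap.ker (shiftedXYZ (2 * n + 1) ζ) := by
    ext x
    rw [mem_eigenspace_susyXYZ, LinearMap.mem_ker]
    push_cast
    rw [neg_add_cancel, zero_smul]
  have h1 : ∃ Ψ, IsPsi n ζ Ψ := by
    simpa only [IsPsi, phi_eq_cocycle] using exists_zeroEnergy hζ heven hpos one_lt_two
  have h0 : ∃ Ψ, IsPsiBar n ζ Ψ := by
    simpa only [IsPsiBar, phiBar_eq_cocycle] using exists_zeroEnergy hζ heven hpos two_pos
  refine ⟨⟨?_, fun E hEv => ?_⟩, h1, h0, ?_⟩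
  · obtain ⟨Ψ, hΨ, -⟩ := h1
    refine Module.End.hasEigenvalue_of_hasEigenvector (x := Ψ) ⟨?_, hΨ.1⟩
    exact hE.ge (shiftedXYZ_of_zeroEnergy heven hpos hΨ)
  · have := nonneg_of_hasEigenvalue heven hpos hEv
    push_cast at this
    linarith
  · rintro Ψ Ψ' ⟨hΨ, c, α, -, hc⟩ ⟨hΨ', c', α', -, hc'⟩
    rw [phi_eq_cocycle] at hc
    rw [phiBar_eq_cocycle] at hc'
    rw [hE]
    exact span_zeroEnergy hζ heven hpos (linearIndependent_zeroEnergy hζ heven hpos one_lt_two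
      two_pos one_ne_zero hΨ hΨ' hc hc') hΨ hΨ'
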